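/- **Setting.** Let $d\ge1$, $K,U\ge 0$ be integers and $M=K+U$. A safe linear bandit problem consists of a compact convex set $\mathcal X\subset\mathbb R^d$, an unknown objective $\theta^*\in\mathbb R^d$, constraint vectors $a^1,\dots,a^M\in\mathbb R^d$ (the first $K$ known, the last $U$ unknown) and known levels $\alpha^1,\dots,\alpha^M\in\mathbb R$. For $J\subset[1:M]$ let $A(J),\alpha(J)$ stack the $a^j$ and $\alpha^j$, $j\in J$. Let $\mathcal K=\{x\in\mathcal X:\langle a^i,x\rangle\le\alpha^i\ \forall i\le K\}$ be the known domain and $\mathcal S=\{x\in\mathcal K:\langle a^i,x\rangle\le\alpha^i\ \forall i>K\}$ the feasible set. Assume: $\|x\|\le1$ on $\mathcal X$; $\|\theta^*\|\le 1$ and $\|a^i\|\le1$ for all $i$; $\langle\theta^*,\cdot\rangle$ has a unique maximiser $x^*$ over $\mathcal S$ (in particular $\mathcal S\neq\varnothing$); (polytopal domain) $\mathcal K$ is the polytope cut out by the known constraints, $\mathcal K=\{x\in\mathbb R^d:\langle a^i,x\rangle\le\alpha^i\ \forall i\le K\}$; (non-degenerate LP) if $Ax\le\alpha$ and $d$ constraints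 with linearly independent vectors are active at $x$, then no other constraint is active at $x$. **Feedback.** In round $t=1,2,\dots$ an action $x_t\in\mathcal K$ (a random vector) is played and $r_t=\langle\theta^*,x_t\rangle+\gamma^0_t$, $s^i_t=\langle a^i,x_t\rangle+\gamma^i_t$ $(1\le i\le M)$ are observed. With $\mathcal F_t$ the $\sigma$-algebra generated by $x_t$ and by $x_\tau,r_\tau,s_\tau^i$ for $\tau<t$, $i\le M$, the noise satisfies $\mathbb E[\gamma_t^i\mid\mathcal F_t]=0$ and $\mathbb E[e^{\xi\gamma_t^i}\mid\mathcal F_t]\le e^{\xi^2/2}$ for all $\xi\in\mathbb R$, $0\le i\le M$. **The algorithm $\mathrm{DOSLB}(\lambda,\delta)$**, $\lambda>0$, $\delta\in(0,1)$. Put $V_t=\lambda I+\sum_{\tau\le t}x_\tau x_\tau^\top$, $\hat\theta_t=V_t^{-1}\sum_{\tau\le t}r_\tau x_\tau$, $\hat a^i_t=V_t^{-1}\sum_{\tau\le t}s^i_\tau x_\tau$, $\|z\|_V=\sqrt{z^\top Vz}$ and $$\sqrt{\beta_t}=\sqrt{2\log\frac{(U+1)\det(V_t)^{1/2}\det(\lambda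 I)^{-1/2}}{\delta}}+\sqrt\lambda .$$ Before round $t$ let $C^0_t=\{\theta:\|\theta-\hat\theta_{t-1}\|_{V_{t-1}}\le\sqrt{\beta_{t-1}}\}$, $C_t^i=\{a^i\}$ for $i\le K$, $C_t^i=\{a:\|a-\hat a^i_{t-1}\|_{V_{t-1}}\le\sqrt{\beta_{t-1}}\}$ for $i>K$, and $\widetilde{\mathcal S}_t=\{x\in\mathcal K:\min_{\tilde a\in C_t^i}\langle\tilde a,x\rangle\le\alpha^i\ \forall i\le M\}$. If $\widetilde{\mathcal S}_t\ne\varnothing$, then $(x_t,\tilde\theta_t)\in\arg\max_{x\in\widetilde{\mathcal S}_t,\,\tilde\theta\in C_t^0}\langle\tilde\theta,x\rangle$ for some $\tilde\theta_t$, with ties broken arbitrarily, except that if the maximum is exactly $0$ then $x_t$ is an extreme point of the set of optimal actions (not in an open segment between two distinct optimal actions). If $\widetilde{\mathcal S}_t=\varnothing$, then $x_t\in\mathcal K$ is arbitrary. **The gap $\Xi$.** A basic index set (BIS) is $I\subset[1:M]$ with $|I|=d$. Write $I\sim x$ if $x\in\mathcal K$ and $A(I)x=\alpha(I)$; $I$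 is consistent if $I\sim x$ for some $x$, and suboptimal if $I\not\sim x^*$. For $L\subset[1:M]$, $J\subset[1:K]\setminus L$ and $v\in\mathbb R^d$ write $L_K=L\cap[1:K]$, $L_U=L\setminus[1:K]$ and let $\Pi(v;L,J)$ be the linear program of minimising $\langle\pi,\alpha(L_U)\rangle+\langle\rho,\alpha(L_K)\rangle+\langle\sigma,\alpha(J)\rangle$ subject to $\pi^\top A(L_U)+\rho^\top A(L_K)+\sigma^\top A(J)=v^\top$, $\sigma\ge0$. Let $\operatorname{spread}(v;L,J)$ be the infimum of $1+\|\pi\|_1$ over its optimisers $(\pi,\rho,\sigma)$ (with $\inf\varnothing=\infty$, $c/\infty=0$). * For consistent $I$, $\Delta_I=\dfrac{\max(0,\min_{x:I\sim x}\langle\theta^*,x^*-x\rangle)}{\operatorname{spread}(\theta^*;I,[1:K]\setminus I)}$ and $\Gamma_I=\max_{k\in[1:M]\setminus I}\dfrac{\inf_{x:I\sim x}\langle a^k,x\rangle-\alpha^k}{\operatorname{spread}(-a^k;I,[1:K]\setminus(I\cup\{k\}))}$ (zero if there is no such $k$), and $\Lambda_I=0$. * For inconsistent $I$, $\Delta_I=\Gamma_I=0$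 and $$\Lambda_I=\max_{\tilde I,\tilde J,k}\max\left(\frac{\max(0,\inf_{x\in\mathcal X(\tilde I,\tilde J)}\langle a^k,x\rangle-\alpha^k)}{\operatorname{spread}(-a^k;\tilde I,\tilde J)},\ \frac{-\min(0,\sup_{x\in\mathcal X(\tilde I,\tilde J)}\langle a^k,x\rangle-\alpha^k)\,\mathbb I\{k\in I\}}{\operatorname{spread}(a^k;\tilde I,\tilde J)}\right)$$ over $\tilde I\subset I$, $\tilde J\subset[1:K]\setminus I$ and $k\in[1:M]\setminus(\tilde I\cup\tilde J)$ such that $\mathcal X(\tilde I,\tilde J)=\{x\in\mathbb R^d:A(\tilde I)x=\alpha(\tilde I),A(\tilde J)x\le\alpha(\tilde J)\}\ne\varnothing$. Finally $\Xi=\min\{\max(\Delta_I,\Gamma_I,\Lambda_I): I\text{ a suboptimal BIS}\}$. **Theorem.** For $\epsilon>0$ let $\mathrm{Regret}^\epsilon_T=\sum_{t\le T}\max\bigl(\langle\theta^*,x^*-x_t\rangle,\ \max_i(\langle a^i,x_t\rangle-\alpha^i-\epsilon)_+\bigr)$. For all $U$, $\lambda>0$ and $\delta\in(0,1)$ there is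 a constant $C$, depending only on $(U,\lambda,\delta)$, such that for all $d,K$, every problem and every run of $\mathrm{DOSLB}(\lambda,\delta)$ as above, with probability at least $1-\delta$, simultaneously for all $T\ge2$ and $\epsilon>0$: $$\mathrm{Regret}^\epsilon_T\le C\,(d\log T)^2\Bigl(\frac1\Xi+\frac1\epsilon\Bigr)\quad\text{(if }\Xi>0;\text{ the bound is vacuous if }\Xi=0),$$ $$\#\bigl\{t\le T:\max_i(\langle a^i,x_t\rangle-\alpha^i)>\epsilon\bigr\}\le C\,\frac{d^2\log^2T}{\epsilon^2}.$$ -/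

import Mathlib

open MeasureTheory ProbabilityTheory
open scoped RealInnerProductSpace

noncomputable section

namespace SafeBandit

/-- The action space `ℝ^d` with its Euclidean structure. -/
abbrev Vec (d : ℕ) : Type := EuclideanSpace ℝ (Fin d)

/-- Constraint indices: `Sum.inl` for the `K` known constraints, `Sum.inr` for the `U` unknown
ones. -/
abbrev Idx (K U : ℕ) : Type := Fin K ⊕ Fin U

/-- The data of a safe linear bandit problem. -/
structure Problem (d K U : ℕ) where
  /-- the a priori domain -/
  X : Set (Vec d)
  /-- the objective vector -/
  θ : Vec d
  /-- the constraint vectors -/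
  a : Idx K U → Vec d
  /-- the constraint levels -/
  α : Idx K U → ℝ

variable {d K U : ℕ}

namespace Problem

/-- The known domain `𝒦`. -/
def knownDomain (P : Problem d K U) : Set (Vec d) :=
  {x | x ∈ P.X ∧ ∀ i : Fin K, ⟪P.a (Sum.inl i), x⟫ ≤ P.α (Sum.inl i)}

/-- The feasible set `𝒮`. -/
def feasibleSet (P : Problem d K U) : Set (Vec d) :=
  {x | x ∈ P.knownDomain ∧ ∀ i : Fin U, ⟪P.a (Sum.inr i), x⟫ ≤ P.α (Sum.inr i)}

/-- `xs` is the unique maximiser of `⟪θ, ·⟫` over the feasible set. -/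
def IsUniqueOptimum (P : Problem d K U) (xs : Vec d) : Prop :=
  xs ∈ P.feasibleSet ∧ ∀ x ∈ P.feasibleSet, x ≠ xs → ⟪P.θ, x⟫ < ⟪P.θ, xs⟫

/-- The domain is compact, convex and inside the unit ball; the parameters have norm at
most one. -/
structure IsBounded (P : Problem d K U) : Prop where
  isCompact : IsCompact P.X
  convex : Convex ℝ P.X
  norm_domain_le : ∀ x ∈ P.X, ‖x‖ ≤ 1
  norm_objective_le : ‖P.θ‖ ≤ 1
  norm_constraint_le : ∀ i, ‖P.a i‖ ≤ 1

/-- The known domain is the polytope cut out by the known linear constraints. -/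
def IsPolytopal (P : Problem d K U) : Prop :=
  P.knownDomain = {x | ∀ i : Fin K, ⟪P.a (Sum.inl i), x⟫ ≤ P.α (Sum.inl i)}

/-- Every basic feasible solution of `A x ≤ α` is non-degenerate: a feasible point at which `d`
constraints with linearly independent constraint vectors are active has no further active
constraint. -/
def IsNondegenerate (P : Problem d K U) : Prop :=
  ∀ x : Vec d, (∀ i, ⟪P.a i, x⟫ ≤ P.α i) →
    ∀ I : Finset (Idx K U), I.card = d →
      LinearIndependent ℝ (fun i : I => P.a i) → (∀ i ∈ I, ⟪P.a i, x⟫ = P.α i) →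
        ∀ j, ⟪P.a j, x⟫ = P.α j → j ∈ I

/-! ### Basic index sets and gaps -/

/-- `I ∼ x`: the point `x ∈ 𝒦` meets all constraints in `I` with equality. -/
def Associated (P : Problem d K U) (I : Finset (Idx K U)) (x : Vec d) : Prop :=
  x ∈ P.knownDomain ∧ ∀ i ∈ I, ⟪P.a i, x⟫ = P.α i

/-- `I` has an associated point. -/
def Consistent (P : Problem d K U) (I : Finset (Idx K U)) : Prop :=
  ∃ x, P.Associated I x

/-- Feasibility for the program `Π(v; L, J)`. The variables `(π, ρ, σ)` are collected in one
vector `y` of multipliers, vanishing off `L ∪ J`: `π` is its part on the unknown constraints of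
`L`, `ρ` its part on the known constraints of `L`, and `σ ≥ 0` its part on `J`. -/
def DualFeasible (P : Problem d K U) (v : Vec d) (L : Finset (Idx K U)) (J : Finset (Fin K))
    (y : Idx K U → ℝ) : Prop :=
  (∀ i : Fin U, Sum.inr i ∉ L → y (Sum.inr i) = 0) ∧
  (∀ i : Fin K, Sum.inl i ∉ L → i ∉ J → y (Sum.inl i) = 0) ∧
  (∀ i ∈ J, 0 ≤ y (Sum.inl i)) ∧
  ∑ i, y i • P.a i = v

/-- `y` optimises (minimises) the program `Π(v; L, J)`. -/
def DualOptimal (P : Problem d K U) (v : Vec d) (L : Finset (Idx K U)) (J : Finset (Fin K))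
    (y : Idx K U → ℝ) : Prop :=
  P.DualFeasible v L J y ∧
    ∀ z, P.DualFeasible v L J z → ∑ i, y i * P.α i ≤ ∑ i, z i * P.α i

/-- `spread(v; L, J)`: the infimum of `1 + ‖π‖₁` over the optimisers of `Π(v; L, J)`. If there is
no optimiser the value is `0`, and quotients by it are `0`, as for a spread equal to `+∞`. -/
def spread (P : Problem d K U) (v : Vec d) (L : Finset (Idx K U)) (J : Finset (Fin K)) : ℝ :=
  sInf {s | ∃ y, P.DualOptimal v L J y ∧ s = 1 + ∑ i : Fin U, |y (Sum.inr i)|}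

open Classical in
/-- The known constraints outside `I`. -/
def knownOutside (I : Finset (Idx K U)) : Finset (Fin K) :=
  Finset.univ.filter fun i => Sum.inl i ∉ I

/-- Efficiency separation: how close the value of points associated with `I` can get to the
optimal value, `max (0, min_{x : I ∼ x} ⟪θ, xs - x⟫)`. -/
def effSeparation (P : Problem d K U) (xs : Vec d) (I : Finset (Idx K U)) : ℝ :=
  max 0 (sInf {q | ∃ x, P.Associated I x ∧ q = ⟪P.θ, xs - x⟫})

open Classical in
/-- Efficiency gap `Δ_I` (zero for an inconsistent `I`). -/
def effGap (P : Problem d K U) (xs : Vec d) (I : Finset (Idx K U)) : ℝ :=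
  if P.Consistent I then P.effSeparation xs I / P.spread P.θ I (knownOutside I) else 0

/-- Feasibility separation `γ(I; k)`. -/
def feasSeparation (P : Problem d K U) (I : Finset (Idx K U)) (k : Idx K U) : ℝ :=
  sInf {q | ∃ x, P.Associated I x ∧ q = ⟪P.a k, x⟫ - P.α k}

open Classical in
/-- Feasibility gap `Γ_I` (zero for an inconsistent `I`). -/
def feasGap (P : Problem d K U) (I : Finset (Idx K U)) : ℝ :=
  if P.Consistent I then
    sSup {q | ∃ k, k ∉ I ∧
      q = P.feasSeparation I k / P.spread (-P.a k) I (knownOutside (insert k I))}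
  else 0

/-- `𝒳(I', J)`: equality on `I'`, inequality on `J`. -/
def partialSet (P : Problem d K U) (I' : Finset (Idx K U)) (J : Finset (Fin K)) : Set (Vec d) :=
  {x | (∀ i ∈ I', ⟪P.a i, x⟫ = P.α i) ∧ ∀ j ∈ J, ⟪P.a (Sum.inl j), x⟫ ≤ P.α (Sum.inl j)}

/-- Outer consistency separation. If `⟪a k, ·⟫` is unbounded below on `𝒳(I', J)` then it is `0`
(Lean's `sInf` is `0` there, which agrees with the value `-∞` after the maximum with `0`). -/
def outerSeparation (P : Problem d K U) (I' : Finset (Idx K U)) (J : Finset (Fin K))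
    (k : Idx K U) : ℝ :=
  max 0 (sInf {q | ∃ x ∈ P.partialSet I' J, q = ⟪P.a k, x⟫ - P.α k})

open Classical in
/-- Inner consistency separation, with the same convention if `⟪a k, ·⟫` is unbounded above. -/
def innerSeparation (P : Problem d K U) (I I' : Finset (Idx K U)) (J : Finset (Fin K))
    (k : Idx K U) : ℝ :=
  if k ∈ I then -min 0 (sSup {q | ∃ x ∈ P.partialSet I' J, q = ⟪P.a k, x⟫ - P.α k}) else 0

open Classical in
/-- Consistency gap `Λ_I` of an inconsistent `I` (zero for a consistent `I`). -/
def conGap (P : Problem d K U) (I : Finset (Idx K U)) : ℝ :=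
  if P.Consistent I then 0 else
    sSup {q | ∃ (I' : Finset (Idx K U)) (J : Finset (Fin K)) (k : Idx K U),
      I' ⊆ I ∧ J ⊆ knownOutside I ∧ (P.partialSet I' J).Nonempty ∧
      k ∉ I' ∧ (∀ j ∈ J, k ≠ Sum.inl j) ∧
      q = max (P.outerSeparation I' J k / P.spread (-P.a k) I' J)
            (P.innerSeparation I I' J k / P.spread (P.a k) I' J)}

/-- The gap `Ξ` of the problem: the minimum of `max (Δ_I, Γ_I, Λ_I)` over the suboptimal basic
index sets `I`, i.e. the sets of `d` constraints that are not associated with the optimum. -/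
def gap (P : Problem d K U) (xs : Vec d) : ℝ :=
  sInf {q | ∃ I : Finset (Idx K U), I.card = d ∧ ¬ P.Associated I xs ∧
    q = max (P.effGap xs I) (max (P.feasGap I) (P.conGap I))}

/-! ### Regret -/

/-- The `ε`-relaxed regret over the first `T` rounds of a sequence of actions. -/
def relaxedRegret (P : Problem d K U) (xs : Vec d) (ε : ℝ) (x : ℕ → Vec d) (T : ℕ) : ℝ :=
  ∑ t ∈ Finset.range T,
    max ⟪P.θ, xs - x t⟫ (⨆ i, max (⟪P.a i, x t⟫ - P.α i - ε) 0)

open Classical in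
/-- The number of the first `T` rounds in which some constraint is violated by more than `ε`. -/
def violationCount (P : Problem d K U) (ε : ℝ) (x : ℕ → Vec d) (T : ℕ) : ℕ :=
  ((Finset.range T).filter fun t => ∃ i, ε < ⟪P.a i, x t⟫ - P.α i).card

end Problem

/-! ### Confidence sets. Rounds are numbered from `0`; a subscript `t` refers to the data of the
`t` rounds that precede round `t`. -/

/-- The regularised design matrix `V = lam I + ∑_{τ < t} x_τ x_τᵀ`. -/
def design (lam : ℝ) (x : ℕ → Vec d) (t : ℕ) : Matrix (Fin d) (Fin d) ℝ :=
  lam • (1 : Matrix (Fin d) (Fin d) ℝ) +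
    ∑ τ ∈ Finset.range t, Matrix.vecMulVec (x τ).ofLp (x τ).ofLp

/-- The regularised least squares estimate `V⁻¹ ∑_{τ < t} y_τ x_τ` from responses `y`. -/
def estimate (lam : ℝ) (x : ℕ → Vec d) (y : ℕ → ℝ) (t : ℕ) : Vec d :=
  WithLp.toLp 2 ((design lam x t)⁻¹.mulVec (∑ τ ∈ Finset.range t, y τ • (x τ).ofLp))

/-- `‖z‖_V = (zᵀ V z)^{1/2}`. -/
def matNorm (V : Matrix (Fin d) (Fin d) ℝ) (z : Vec d) : ℝ :=
  √(z.ofLp ⬝ᵥ V.mulVec z.ofLp)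

/-- The confidence radius, with `U` unknown constraints. -/
def radius (U : ℕ) (lam δ : ℝ) (x : ℕ → Vec d) (t : ℕ) : ℝ :=
  √(2 * Real.log (((U : ℝ) + 1) * √(design lam x t).det /
      √(lam • (1 : Matrix (Fin d) (Fin d) ℝ)).det / δ)) + √lam

/-- The confidence ellipsoid around the least squares estimate. -/
def ellipsoid (U : ℕ) (lam δ : ℝ) (x : ℕ → Vec d) (y : ℕ → ℝ) (t : ℕ) : Set (Vec d) :=
  {v | matNorm (design lam x t) (v - estimate lam x y t) ≤ radius U lam δ x t}

namespace Problem

/-- The confidence set of a constraint vector: a singleton for a known constraint. -/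
def confSet (P : Problem d K U) (lam δ : ℝ) (x : ℕ → Vec d) (s : ℕ → Idx K U → ℝ) (t : ℕ) :
    Idx K U → Set (Vec d)
  | Sum.inl i => {P.a (Sum.inl i)}
  | Sum.inr i => ellipsoid U lam δ x (fun τ => s τ (Sum.inr i)) t

/-- The optimistic permissible set. (The confidence sets are compact, so that the minimum of
`⟪v, x⟫` over one of them is at most `α i` iff some `v` in it has `⟪v, x⟫ ≤ α i`.) -/
def permissible (P : Problem d K U) (lam δ : ℝ) (x : ℕ → Vec d) (s : ℕ → Idx K U → ℝ) (t : ℕ) :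
    Set (Vec d) :=
  {z | z ∈ P.knownDomain ∧ ∀ i, ∃ v ∈ P.confSet lam δ x s t i, ⟪v, z⟫ ≤ P.α i}

end Problem

/-- The maximisers `(z, v)` of `⟪v, z⟫` over `z ∈ S`, `v ∈ C`. -/
def optimisticPairs (S C : Set (Vec d)) : Set (Vec d × Vec d) :=
  {p | p.1 ∈ S ∧ p.2 ∈ C ∧ ∀ z ∈ S, ∀ v ∈ C, ⟪v, z⟫ ≤ ⟪p.2, p.1⟫}

namespace Problem

/-- The sequence `x` of actions, with rewards `r` and safety feedback `s`, is a run of the doubly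
optimistic strategy with parameters `lam, δ`. Every action lies in the known domain; whenever the
permissible set is nonempty, the action and some parameter of the reward confidence set jointly
maximise the optimistic reward. If that optimistic reward is exactly zero, then among all optimal
actions an extreme one is played; for a nonzero optimistic reward ties may be broken in any way. -/
def IsDOSLB (P : Problem d K U) (lam δ : ℝ) (x : ℕ → Vec d) (r : ℕ → ℝ)
    (s : ℕ → Idx K U → ℝ) : Prop :=
  ∀ t, x t ∈ P.knownDomain ∧
    ((P.permissible lam δ x s t).Nonempty →
      ∃ v, (x t, v) ∈ optimisticPairs (P.permissible lam δ x s t) (ellipsoid U lam δ x r t) ∧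
        (⟪v, x t⟫ = 0 → x t ∈ Set.extremePoints ℝ (Prod.fst ''
          optimisticPairs (P.permissible lam δ x s t) (ellipsoid U lam δ x r t))))

/-! ### The stochastic feedback -/

variable {Ω : Type*}

/-- The reward in round `t`; `none` indexes the reward noise. -/
def reward (P : Problem d K U) (x : ℕ → Ω → Vec d) (γ : ℕ → Option (Idx K U) → Ω → ℝ)
    (t : ℕ) (ω : Ω) : ℝ :=
  ⟪P.θ, x t ω⟫ + γ t none ω

/-- The safety feedback in round `t` on constraint `i`. -/
def safety (P : Problem d K U) (x : ℕ → Ω → Vec d) (γ : ℕ → Option (Idx K U) → Ω → ℝ)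
    (t : ℕ) (i : Idx K U) (ω : Ω) : ℝ :=
  ⟪P.a i, x t ω⟫ + γ t (some i) ω

/-- The information available when the feedback of round `t` is drawn: the σ-algebra generated by
the actions, rewards and safety feedback of the rounds before `t` and by the action of round
`t`. -/
@[reducible] def info (P : Problem d K U) (x : ℕ → Ω → Vec d) (γ : ℕ → Option (Idx K U) → Ω → ℝ)
    (t : ℕ) : MeasurableSpace Ω :=
  (⨆ τ : Fin t, MeasurableSpace.comap (x τ) inferInstance ⊔
      MeasurableSpace.comap (P.reward x γ τ) inferInstance ⊔
      ⨆ i, MeasurableSpace.comap (P.safety x γ τ i) inferInstance) ⊔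
    MeasurableSpace.comap (x t) inferInstance

/-- All noises are conditionally centred and conditionally 1-sub-Gaussian. The integrability is
part of the finiteness of the conditional moment generating function. -/
structure IsSubGaussianNoise [MeasurableSpace Ω] (P : Problem d K U) (μ : Measure Ω)
    (x : ℕ → Ω → Vec d) (γ : ℕ → Option (Idx K U) → Ω → ℝ) : Prop where
  measurable : ∀ t i, Measurable (γ t i)
  integrable_exp : ∀ t i (ξ : ℝ), Integrable (fun ω => Real.exp (ξ * γ t i ω)) μ
  centred : ∀ t i, μ[γ t i | P.info x γ t] =ᵐ[μ] 0
  subGaussian : ∀ t i (ξ : ℝ),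
    μ[fun ω => Real.exp (ξ * γ t i ω) | P.info x γ t] ≤ᵐ[μ] fun _ => Real.exp (ξ ^ 2 / 2)

end Problem

end SafeBandit

end

noncomputable section

namespace SafeBandit

open scoped ENNReal

variable {d K U : ℕ}

/-! Suppose all confidence ellipsoids contain the true parameters. Then each round is deterministic:
with `ρ_t` the `width`, optimism bounds every violation and the loss `⟪θ, xs - x_t⟫` by `ρ_t`. The
main point (`Problem.round_bounds`) is that a positive loss forces the gap to be at most `ρ_t`.

To see this, freeze each unknown constraint at the point of its ellipsoid that has the smallest
inner product with `x_t`. The frozen constraints cut out a polyhedron inside the permissible set,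
and `x_t` maximises over it the convex function `⟪c₀, z⟫ + r ‖D z‖`. This function is strictly
convex except along rays, so, with the tie rule for value zero, `x_t` is a vertex and `d` frozen
constraints are active there; let `I` be their index set. If `I` belongs to the optimum,
non-degeneracy writes `θ` as a nonnegative combination of the `a i`, `i ∈ I`. The true constraints
in `I` have value at least `α i` at `x_t`, so the loss is not positive. Otherwise `I` is suboptimal
and `x_t` meets its constraints up to `ρ_t`; LP duality (`sub_sSup_div_spread_le`, `max_gaps_le`)
then bounds all three gaps of `I` by `ρ_t`.

Hence a round contributes only if `ρ_t` reaches the gap or exceeds `ε`, and then at most `ρ_t²`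
times the reciprocal of that threshold. The elliptical potential bound gives `∑ ρ_t² = O((d log
T)²)`. Validity of the ellipsoids comes from the method of mixtures: a Gaussian mixture of
exponential supermartingales has a closed form, and Ville's inequality controls it at all times at
once. -/

/-! ### Farkas' lemma -/

/-- **Farkas' lemma** for finitely many linear functionals. -/
theorem farkas_finset {E ι : Type*} [AddCommGroup E] [Module ℝ E] [DecidableEq ι]
    (s : Finset ι) :
    ∀ (f : ι → E →ₗ[ℝ] ℝ) (g : E →ₗ[ℝ] ℝ),
      (∀ x, (∀ i ∈ s, f i x ≤ 0) → g x ≤ 0) →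
      ∃ y : ι → ℝ, (∀ i ∈ s, 0 ≤ y i) ∧ ∀ x, g x = ∑ i ∈ s, y i * f i x := by
  induction s using Finset.induction_on with
  | empty =>
    intro f g h
    refine ⟨0, by simp, fun x => ?_⟩
    have h1 := h x (by simp)
    have h2 := h (-x) (by simp)
    simp only [map_neg] at h2
    simp only [Finset.sum_empty]
    linarith
  | insert j s hj ih =>
    intro f g h
    by_cases hc : ∀ x, (∀ i ∈ s, f i x ≤ 0) → g x ≤ 0
    · obtain ⟨y, hy, hg⟩ := ih f g hc
      refine ⟨fun i => if i = j then 0 else y i, ?_, fun x => ?_⟩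
      · intro i hi
        by_cases hij : i = j
        · simp [hij]
        · simpa [hij] using hy i (Finset.mem_of_mem_insert_of_ne hi hij)
      · rw [Finset.sum_insert hj, hg x]
        simp only [if_true, zero_mul, zero_add]
        refine Finset.sum_congr rfl fun i hi => ?_
        rw [if_neg (ne_of_mem_of_not_mem hi hj)]
    · push Not at hc
      obtain ⟨x₀, hx₀, hg₀⟩ := hc
      have hj₀ : 0 < f j x₀ := by
        by_contra hle
        push Not at hle
        have := h x₀ (by
          intro i hi
          rcases Finset.mem_insert.1 hi with rfl | hi
          · exact hle
          · exact hx₀ i hi)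
        linarith
      -- All functionals are composed with the projection onto the kernel of `f j` along `x₀`.
      -- Projected points satisfy constraint `j` with equality, so the hypothesis for `insert j s`
      -- applies to them.
      obtain ⟨y, hy, hg⟩ := ih (fun i => f i - (f i x₀ / f j x₀) • f j)
        (g - (g x₀ / f j x₀) • f j) (by
          intro x hx
          have key := h (x - (f j x / f j x₀) • x₀) (by
            intro i hi
            rcases Finset.mem_insert.1 hi with rfl | hi
            · simp only [map_sub, map_smul, smul_eq_mul]
              rw [div_mul_cancel₀ _ hj₀.ne', sub_self]
            · have := hx i hi
              simp only [LinearMap.sub_apply, LinearMap.smul_apply, smul_eq_mul] at this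
              simp only [map_sub, map_smul, smul_eq_mul]
              calc _ = f i x - f i x₀ / f j x₀ * f j x := by ring
                _ ≤ 0 := this)
          simp only [map_sub, map_smul, smul_eq_mul] at key
          simp only [LinearMap.sub_apply, LinearMap.smul_apply, smul_eq_mul]
          calc _ = g x - f j x / f j x₀ * g x₀ := by ring
            _ ≤ 0 := key)
      refine ⟨fun i => if i = j then g x₀ / f j x₀ - ∑ i ∈ s, y i * (f i x₀ / f j x₀) else y i,
        ?_, fun x => ?_⟩
      · intro i hi
        by_cases hij : i = j
        · simp only [hij, if_true]
          have h1 : ∑ i ∈ s, y i * (f i x₀ / f j x₀) ≤ 0 :=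
            Finset.sum_nonpos fun i hi => mul_nonpos_of_nonneg_of_nonpos (hy i hi)
              (div_nonpos_of_nonpos_of_nonneg (hx₀ i hi) hj₀.le)
          have h2 : 0 ≤ g x₀ / f j x₀ := by positivity
          linarith
        · simpa [hij] using hy i (Finset.mem_of_mem_insert_of_ne hi hij)
      · rw [Finset.sum_insert hj]
        have h1 := hg x
        simp only [LinearMap.sub_apply, LinearMap.smul_apply, smul_eq_mul] at h1
        have h2 : ∑ i ∈ s, (if i = j then g x₀ / f j x₀ - ∑ i ∈ s, y i * (f i x₀ / f j x₀)
            else y i) * f i x = ∑ i ∈ s, y i * f i x :=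
          Finset.sum_congr rfl fun i hi => by rw [if_neg (ne_of_mem_of_not_mem hi hj)]
        have h3 : ∑ i ∈ s, y i * (f i x - f i x₀ / f j x₀ * f j x)
            = ∑ i ∈ s, y i * f i x - (∑ i ∈ s, y i * (f i x₀ / f j x₀)) * f j x := by
          rw [Finset.sum_mul, ← Finset.sum_sub_distrib]
          exact Finset.sum_congr rfl fun i _ => by ring
        rw [h2]
        simp only [if_true]
        linarith [h1.trans h3]

/-- Farkas' lemma for vectors: a vector that is nonpositive on the polar cone of finitely many
vectors is a nonnegative combination of them. -/
theorem farkas_inner {ι : Type*} [DecidableEq ι] (s : Finset ι) (a : ι → Vec d) (v : Vec d)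
    (h : ∀ u, (∀ i ∈ s, ⟪a i, u⟫ ≤ 0) → ⟪v, u⟫ ≤ 0) :
    ∃ y : ι → ℝ, (∀ i ∈ s, 0 ≤ y i) ∧ v = ∑ i ∈ s, y i • a i := by
  obtain ⟨y, hy, hg⟩ := farkas_finset s (fun i => (innerₛₗ ℝ (a i))) (innerₛₗ ℝ v)
    (by simpa using h)
  refine ⟨y, hy, ext_inner_right ℝ fun x => ?_⟩
  simpa [sum_inner, inner_smul_left] using hg x

/-- The affine form of Farkas' lemma. -/
theorem farkas_affine {ι : Type*} [Fintype ι] [DecidableEq ι] (a : ι → Vec d) (b : ι → ℝ)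
    (h : ¬ ∃ x, ∀ i, ⟪a i, x⟫ ≤ b i) :
    ∃ y : ι → ℝ, (∀ i, 0 ≤ y i) ∧ ∑ i, y i • a i = 0 ∧ ∑ i, y i * b i < 0 := by
  -- Homogenisation: the system `⟪a i, x⟫ ≤ t * b i` has no solution with `t > 0`, so the functional
  -- `t` is nonpositive on its solution cone.
  obtain ⟨y, hy, hg⟩ := farkas_finset (E := Vec d × ℝ) Finset.univ
    (fun i => (innerₛₗ ℝ (a i)) ∘ₗ LinearMap.fst ℝ _ _ - (b i) • LinearMap.snd ℝ _ _)
    (LinearMap.snd ℝ _ _) (by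
      rintro ⟨x, t⟩ hx
      by_contra! ht
      simp only [LinearMap.snd_apply] at ht
      refine h ⟨t⁻¹ • x, fun i => ?_⟩
      have := hx i (Finset.mem_univ _)
      simp only [LinearMap.sub_apply, LinearMap.comp_apply, LinearMap.fst_apply,
        LinearMap.smul_apply, LinearMap.snd_apply, smul_eq_mul, innerₛₗ_apply_apply] at this
      rw [inner_smul_right, inv_mul_le_iff₀ ht]
      linarith)
  refine ⟨y, fun i => hy i (Finset.mem_univ _), ext_inner_right ℝ fun x => ?_, ?_⟩
  · have := hg (x, 0)
    simp only [LinearMap.sub_apply, LinearMap.comp_apply, LinearMap.fst_apply,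
        LinearMap.smul_apply, LinearMap.snd_apply, smul_eq_mul, innerₛₗ_apply_apply, mul_zero,
        sub_zero] at this
    simpa [sum_inner, inner_smul_left] using this.symm
  · have := hg (0, 1)
    simp only [LinearMap.sub_apply, LinearMap.comp_apply, LinearMap.fst_apply,
        LinearMap.smul_apply, LinearMap.snd_apply, smul_eq_mul, innerₛₗ_apply_apply, mul_one,
        inner_zero_right, zero_sub, mul_neg, Finset.sum_neg_distrib] at this
    linarith

/-! ### Linear programming duality and the gaps -/

namespace Problem

theorem inner_eq_sum_of_dualFeasible {P : Problem d K U} {v : Vec d} {L : Finset (Idx K U)}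
    {J : Finset (Fin K)} {y : Idx K U → ℝ} (hy : P.DualFeasible v L J y) (x : Vec d) :
    ⟪v, x⟫ = ∑ i, y i * ⟪P.a i, x⟫ := by
  rw [← hy.2.2.2, sum_inner]
  exact Finset.sum_congr rfl fun i _ => real_inner_smul_left _ _ _

/-- Multipliers of a feasible point of the dual program vanish off `L ∪ J`. -/
theorem DualFeasible.eq_zero {P : Problem d K U} {v : Vec d} {L : Finset (Idx K U)}
    {J : Finset (Fin K)} {y : Idx K U → ℝ} (hy : P.DualFeasible v L J y) {i : Idx K U}
    (hL : i ∉ L) (hJ : ∀ j ∈ J, i ≠ Sum.inl j) : y i = 0 := by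
  rcases i with i | i
  · exact hy.2.1 i hL fun h => hJ i h rfl
  · exact hy.1 i hL

/-- Weak duality. -/
theorem inner_le_of_dualFeasible {P : Problem d K U} {v : Vec d} {L : Finset (Idx K U)}
    {J : Finset (Fin K)} {y : Idx K U → ℝ} (hy : P.DualFeasible v L J y) {x : Vec d}
    (hx : x ∈ P.partialSet L J) : ⟪v, x⟫ ≤ ∑ i, y i * P.α i := by
  rw [inner_eq_sum_of_dualFeasible hy]
  refine Finset.sum_le_sum fun i _ => ?_
  by_cases hL : i ∈ L
  · rw [hx.1 i hL]
  · by_cases hJ : ∀ j ∈ J, i ≠ Sum.inl j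
    · simp [hy.eq_zero hL hJ]
    · push Not at hJ
      obtain ⟨j, hj, rfl⟩ := hJ
      exact mul_le_mul_of_nonneg_left (hx.2 j hj) (hy.2.2.1 j hj)

/-- Strong duality: the value of an optimal dual solution is attained by the primal program. -/
theorem exists_mem_partialSet_of_dualOptimal {P : Problem d K U} {v : Vec d}
    {L : Finset (Idx K U)} {J : Finset (Fin K)} {y : Idx K U → ℝ}
    (hy : P.DualOptimal v L J y) (hLJ : ∀ j ∈ J, Sum.inl j ∉ L) :
    ∃ x ∈ P.partialSet L J, ∑ i, y i * P.α i ≤ ⟪v, x⟫ := by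
  classical
  set D := ∑ i, y i * P.α i with hD
  -- `c` switches on the inequalities of `L ∪ J`, and `e` adds the reversed ones on `L`. The other
  -- rows become `0 ≤ 0`, which keeps the index type fixed.
  let c : Idx K U → ℝ := fun i => if i ∈ L ∨ ∃ j ∈ J, i = Sum.inl j then 1 else 0
  let e : Idx K U → ℝ := fun i => if i ∈ L then -1 else 0
  by_contra hcon
  obtain ⟨z, hz0, hza, hzb⟩ := farkas_affine (ι := Option (Idx K U ⊕ Idx K U))
    (fun o => o.elim (-v) (Sum.elim (fun i => c i • P.a i) (fun i => e i • P.a i)))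
    (fun o => o.elim (-D) (Sum.elim (fun i => c i * P.α i) (fun i => e i * P.α i))) (by
      rintro ⟨x, hx⟩
      have hle : ∀ i, (i ∈ L ∨ ∃ j ∈ J, i = Sum.inl j) → ⟪P.a i, x⟫ ≤ P.α i := by
        intro i hi
        simpa [c, hi] using hx (some (Sum.inl i))
      refine hcon ⟨x, ⟨fun i hi => le_antisymm (hle i (Or.inl hi)) ?_,
        fun j hj => hle _ (Or.inr ⟨j, hj, rfl⟩)⟩, ?_⟩
      · simpa [e, hi] using hx (some (Sum.inr i))
      · simpa using hx none)
  rw [Fintype.sum_option, Fintype.sum_sum_type] at hza hzb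
  simp only [Option.elim, Sum.elim_inl, Sum.elim_inr] at hza hzb
  set τ := z none
  let w : Idx K U → ℝ := fun i => z (some (Sum.inl i)) * c i + z (some (Sum.inr i)) * e i
  have hwa : ∑ i, w i • P.a i = τ • v := by
    have : ∑ i, w i • P.a i = ∑ i, z (some (Sum.inl i)) • c i • P.a i
        + ∑ i, z (some (Sum.inr i)) • e i • P.a i := by
      rw [← Finset.sum_add_distrib]
      exact Finset.sum_congr rfl fun i _ => by simp only [w, add_smul, mul_smul]
    rw [this]
    rw [smul_neg, neg_add_eq_zero] at hza
    exact hza.symm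
  have hwb : ∑ i, w i * P.α i < τ * D := by
    have : ∑ i, w i * P.α i = ∑ i, z (some (Sum.inl i)) * (c i * P.α i)
        + ∑ i, z (some (Sum.inr i)) * (e i * P.α i) := by
      rw [← Finset.sum_add_distrib]
      exact Finset.sum_congr rfl fun i _ => by simp only [w]; ring
    rw [this]
    linarith
  have hw0 : ∀ i, i ∉ L → (∀ j ∈ J, i ≠ Sum.inl j) → w i = 0 := by
    intro i hi hj
    have : ¬ (i ∈ L ∨ ∃ j ∈ J, i = Sum.inl j) := by
      push Not; exact ⟨hi, hj⟩
    simp only [w, c, e, if_neg hi, if_neg this, mul_zero, add_zero]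
  have hwJ : ∀ j ∈ J, 0 ≤ w (Sum.inl j) := by
    intro j hj
    have : Sum.inl j ∈ L ∨ ∃ j' ∈ J, (Sum.inl j : Idx K U) = Sum.inl j' := Or.inr ⟨j, hj, rfl⟩
    simp only [w, c, e, if_neg (hLJ j hj), if_pos this, mul_one, mul_zero, add_zero]
    exact hz0 _
  have hfeas : ∀ r s : ℝ, 0 ≤ r → 0 ≤ s → r + s * τ = 1 →
      P.DualFeasible v L J (fun i => r * y i + s * w i) := by
    intro r s hr hs hrs
    refine ⟨fun i hi => ?_, fun i hi hj => ?_, fun j hj => ?_, ?_⟩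
    · simp only [hy.1.1 i hi, hw0 (Sum.inr i) hi (by simp), mul_zero, add_zero]
    · have hj' : ∀ j ∈ J, (Sum.inl i : Idx K U) ≠ Sum.inl j := by
        rintro j hjJ h
        exact hj (Sum.inl_injective h ▸ hjJ)
      simp only [hy.1.2.1 i hi hj, hw0 (Sum.inl i) hi hj', mul_zero, add_zero]
    · exact add_nonneg (mul_nonneg hr (hy.1.2.2.1 j hj)) (mul_nonneg hs (hwJ j hj))
    · simp only [add_smul, mul_smul, Finset.sum_add_distrib, ← Finset.smul_sum]
      rw [hy.1.2.2.2, hwa, smul_smul, ← add_smul, hrs, one_smul]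
  have hval : ∀ r s : ℝ, ∑ i, (r * y i + s * w i) * P.α i = r * D + s * ∑ i, w i * P.α i := by
    intro r s
    simp only [hD, Finset.mul_sum, ← Finset.sum_add_distrib]
    exact Finset.sum_congr rfl fun i _ => by ring
  have hτ0 : 0 ≤ τ := hz0 none
  -- Here `τ` is the Farkas multiplier of the objective. If it vanishes, `w` is a direction along
  -- which the dual value falls from `y`; otherwise `w / τ` is itself a better dual point. Both
  -- contradict optimality.
  rcases hτ0.eq_or_lt with hτ | hτ
  · have h1 := hy.2 _ (hfeas 1 1 zero_le_one zero_le_one (by rw [← hτ]; norm_num))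
    rw [hval] at h1
    rw [← hτ] at hwb
    linarith
  · have h1 := hy.2 _ (hfeas 0 τ⁻¹ le_rfl (by positivity) (by
      rw [zero_add, inv_mul_cancel₀ hτ.ne']))
    rw [hval] at h1
    have h2 : τ⁻¹ * ∑ i, w i * P.α i < D := by
      rw [inv_mul_lt_iff₀ hτ]; exact hwb
    linarith

/-- The objective `v` at a point that meets the constraints of `L` up to an error `ρ`, exactly so
the known ones, exceeds the value of the program `Π(v; L, J)` by at most `ρ ‖π‖₁`. -/
theorem inner_le_of_approx {P : Problem d K U} {v : Vec d} {L : Finset (Idx K U)}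
    {J : Finset (Fin K)} {y : Idx K U → ℝ} (hy : P.DualFeasible v L J y) {x : Vec d} {ρ : ℝ}
    (hK : ∀ i, ⟪P.a (Sum.inl i), x⟫ ≤ P.α (Sum.inl i))
    (hLK : ∀ i, Sum.inl i ∈ L → ⟪P.a (Sum.inl i), x⟫ = P.α (Sum.inl i))
    (hLU : ∀ i, Sum.inr i ∈ L → |⟪P.a (Sum.inr i), x⟫ - P.α (Sum.inr i)| ≤ ρ) :
    ⟪v, x⟫ ≤ ∑ i, y i * P.α i + ρ * ∑ i : Fin U, |y (Sum.inr i)| := by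
  rw [inner_eq_sum_of_dualFeasible hy, Fintype.sum_sum_type, Fintype.sum_sum_type, add_assoc,
    Finset.mul_sum, ← Finset.sum_add_distrib]
  refine add_le_add (Finset.sum_le_sum fun i _ => ?_) (Finset.sum_le_sum fun i _ => ?_)
  · by_cases hL : Sum.inl i ∈ L
    · rw [hLK i hL]
    · by_cases hJ : i ∈ J
      · exact mul_le_mul_of_nonneg_left (hK i) (hy.2.2.1 i hJ)
      · simp [hy.2.1 i hL hJ]
  · by_cases hL : Sum.inr i ∈ L
    · have h1 : y (Sum.inr i) * (⟪P.a (Sum.inr i), x⟫ - P.α (Sum.inr i))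
          ≤ |y (Sum.inr i)| * ρ :=
        (le_abs_self _).trans (by
          rw [abs_mul]; exact mul_le_mul_of_nonneg_left (hLU i hL) (abs_nonneg _))
      linarith
    · simp [hy.1 i hL]

/-- A bound valid for every optimiser passes to the infimum that defines the spread. Without
optimisers the quotient is `0` by the convention for division by zero. -/
theorem div_spread_le {P : Problem d K U} {v : Vec d} {L : Finset (Idx K U)}
    {J : Finset (Fin K)} {q ρ : ℝ} (hρ : 0 ≤ ρ)
    (h : ∀ y, P.DualOptimal v L J y → q ≤ ρ * (1 + ∑ i : Fin U, |y (Sum.inr i)|)) :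
    q / P.spread v L J ≤ ρ := by
  unfold spread
  set S := {s | ∃ y, P.DualOptimal v L J y ∧ s = 1 + ∑ i : Fin U, |y (Sum.inr i)|} with hS
  rcases S.eq_empty_or_nonempty with h0 | hne
  · simpa [h0] using hρ
  · have h1 : 1 ≤ sInf S := le_csInf hne (by
      rintro s ⟨y, -, rfl⟩
      have : 0 ≤ ∑ i : Fin U, |y (Sum.inr i)| := by positivity
      linarith)
    rw [div_le_iff₀ (by linarith)]
    rcases hρ.eq_or_lt with rfl | hρ
    · obtain ⟨_, y, hy, -⟩ := hne
      simpa using h y hy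
    · rw [← div_le_iff₀' hρ]
      refine le_csInf hne ?_
      rintro s ⟨y, hy, rfl⟩
      rw [div_le_iff₀' hρ]
      exact h y hy

/-- Equality on `I` already implies the known inequalities in `I`, and for a polytopal domain
membership in `X` adds nothing. -/
theorem partialSet_knownOutside {P : Problem d K U} (hP : P.IsPolytopal) (I : Finset (Idx K U)) :
    P.partialSet I (knownOutside I) = {x | P.Associated I x} := by
  ext x
  simp only [partialSet, Set.mem_ofPred_eq, Associated]
  rw [hP]
  constructor
  · rintro ⟨h1, h2⟩
    refine ⟨fun i => ?_, h1⟩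
    by_cases hi : Sum.inl i ∈ I
    · exact (h1 _ hi).le
    · exact h2 i (by simp [knownOutside, hi])
  · rintro ⟨h1, h2⟩
    exact ⟨h2, fun j _ => h1 j⟩

/-- If `⟪v, ·⟫` is at least `c` at a point that approximately meets the constraints, then its
supremum over the program is at least `c` up to an error governed by the spread. -/
theorem sub_sSup_div_spread_le {P : Problem d K U} {v : Vec d} {L : Finset (Idx K U)}
    {J : Finset (Fin K)} {x : Vec d} {ρ c : ℝ} (hρ : 0 ≤ ρ) (hLJ : ∀ j ∈ J, Sum.inl j ∉ L)
    (hK : ∀ i, ⟪P.a (Sum.inl i), x⟫ ≤ P.α (Sum.inl i))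
    (hLK : ∀ i, Sum.inl i ∈ L → ⟪P.a (Sum.inl i), x⟫ = P.α (Sum.inl i))
    (hLU : ∀ i, Sum.inr i ∈ L → |⟪P.a (Sum.inr i), x⟫ - P.α (Sum.inr i)| ≤ ρ)
    {q : ℝ} (hq : ∀ y ∈ P.partialSet L J, BddAbove ((fun z => ⟪v, z⟫) '' P.partialSet L J) →
      q ≤ max 0 (c - ⟪v, y⟫))
    (hc : c ≤ ⟪v, x⟫ + ρ) :
    q / P.spread v L J ≤ ρ := by
  refine div_spread_le hρ fun y hy => ?_
  obtain ⟨z, hz, hyz⟩ := exists_mem_partialSet_of_dualOptimal hy hLJ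
  have h1 := inner_le_of_approx hy.1 hK hLK hLU
  -- A dual optimiser makes the primal objective bounded above by weak duality. Only then does the
  -- real `sInf` or `sSup` in a separation have its intended value.
  refine (hq z hz ⟨∑ i, y i * P.α i, ?_⟩).trans (max_le (by positivity) ?_)
  · rintro _ ⟨w, hw, rfl⟩
    exact inner_le_of_dualFeasible hy.1 hw
  -- The chain is `c ≤ ⟪v, x⟫ + ρ ≤ D + ρ ‖π‖₁ + ρ ≤ ⟪v, z⟫ + ρ (1 + ‖π‖₁)`, with `D` the dual
  -- value. The summand `1` in the spread pays for the slack in `hc`.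
  · nlinarith

/-- A point of the known domain at which the constraints of `I` are met up to an error `ρ`, no
constraint is violated by more than `ρ` and the objective falls short of the optimum by at most `ρ`
bounds the gap of `I`. -/
theorem max_gaps_le {P : Problem d K U} (hP : P.IsPolytopal) {xs x : Vec d}
    {I : Finset (Idx K U)} {ρ : ℝ} (hρ : 0 ≤ ρ)
    (hK : ∀ i, ⟪P.a (Sum.inl i), x⟫ ≤ P.α (Sum.inl i))
    (hIK : ∀ i, Sum.inl i ∈ I → ⟪P.a (Sum.inl i), x⟫ = P.α (Sum.inl i))
    (hIU : ∀ i, Sum.inr i ∈ I → |⟪P.a (Sum.inr i), x⟫ - P.α (Sum.inr i)| ≤ ρ)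
    (hviol : ∀ i, ⟪P.a i, x⟫ - P.α i ≤ ρ) (hopt : ⟪P.θ, xs - x⟫ ≤ ρ) :
    max (P.effGap xs I) (max (P.feasGap I) (P.conGap I)) ≤ ρ := by
  classical
  refine max_le ?_ (max_le ?_ ?_)
  · unfold effGap
    split_ifs with hc
    swap
    · exact hρ
    refine sub_sSup_div_spread_le (c := ⟪P.θ, xs⟫) hρ (by simp [knownOutside]) hK hIK hIU ?_ ?_
    · rw [partialSet_knownOutside hP]
      rintro y hy ⟨B, hB⟩
      unfold effSeparation
      refine max_le_max le_rfl (csInf_le ⟨⟪P.θ, xs⟫ - B, ?_⟩ ⟨y, hy, by rw [inner_sub_right]⟩)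
      rintro _ ⟨w, hw, rfl⟩
      rw [inner_sub_right]
      have := hB ⟨w, hw, rfl⟩
      simp only at this
      linarith
    · rw [inner_sub_right] at hopt
      linarith
  · unfold feasGap
    split_ifs with hc
    swap
    · exact hρ
    refine Real.sSup_le ?_ hρ
    rintro _ ⟨k, hk, rfl⟩
    -- Every point associated with `I` satisfies a known `k`, so that separation is at most zero.
    -- Only an unknown `k` needs duality, and inserting it into `I` does not change the known
    -- constraints outside.
    rcases k with k | k
    · obtain ⟨w, hw⟩ := hc
      by_cases hb : BddBelow {q | ∃ x, P.Associated I x ∧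
          q = ⟪P.a (Sum.inl k), x⟫ - P.α (Sum.inl k)}
      · have h1 : P.feasSeparation I (Sum.inl k) ≤ 0 :=
          (csInf_le hb ⟨w, hw, rfl⟩).trans (sub_nonpos.2 (hw.1.2 k))
        refine div_spread_le hρ fun y _ => h1.trans (by positivity)
      · have h1 : P.feasSeparation I (Sum.inl k) = 0 := Real.sInf_of_not_bddBelow hb
        rw [h1, zero_div]
        exact hρ
    · have hJ : knownOutside (insert (Sum.inr k) I) = knownOutside I := by
        ext i
        simp [knownOutside]
      rw [hJ]
      refine sub_sSup_div_spread_le (c := -P.α (Sum.inr k)) hρ (by simp [knownOutside])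
        hK hIK hIU ?_ ?_
      · rw [partialSet_knownOutside hP]
        rintro y hy ⟨B, hB⟩
        refine le_max_of_le_right (csInf_le ⟨-B - P.α (Sum.inr k), ?_⟩
          ⟨y, hy, by rw [inner_neg_left]; ring⟩)
        rintro _ ⟨w, hw, rfl⟩
        have := hB ⟨w, hw, rfl⟩
        simp only [inner_neg_left] at this
        linarith
      · rw [inner_neg_left]
        linarith [hviol (Sum.inr k)]
  · unfold conGap
    split_ifs with hc
    · exact hρ
    refine Real.sSup_le ?_ hρ
    rintro _ ⟨I', J, k, hI', hJ, -, hk, hkJ, rfl⟩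
    have hLJ : ∀ j ∈ J, Sum.inl j ∉ I' := fun j hj h => by
      have := hJ hj
      simp only [knownOutside, Finset.mem_filter, Finset.mem_univ, true_and] at this
      exact this (hI' h)
    refine max_le ?_ ?_
    · refine sub_sSup_div_spread_le (c := -P.α k) hρ hLJ hK (fun i hi => hIK i (hI' hi))
        (fun i hi => hIU i (hI' hi)) ?_ ?_
      · rintro y hy ⟨B, hB⟩
        refine max_le_max le_rfl (csInf_le ⟨-B - P.α k, ?_⟩
          ⟨y, hy, by rw [inner_neg_left]; ring⟩)
        rintro _ ⟨w, hw, rfl⟩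
        have := hB ⟨w, hw, rfl⟩
        simp only [inner_neg_left] at this
        linarith
      · rw [inner_neg_left]
        linarith [hviol k]
    · unfold innerSeparation
      split_ifs with hkI
      swap
      · rw [zero_div]
        exact hρ
      refine sub_sSup_div_spread_le (c := P.α k) hρ hLJ hK (fun i hi => hIK i (hI' hi))
        (fun i hi => hIU i (hI' hi)) ?_ ?_
      · rintro y hy ⟨B, hB⟩
        have h1 : ⟪P.a k, y⟫ - P.α k ≤
            sSup {q | ∃ x ∈ P.partialSet I' J, q = ⟪P.a k, x⟫ - P.α k} := by
          refine le_csSup ⟨B - P.α k, ?_⟩ ⟨y, hy, rfl⟩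
          rintro _ ⟨w, hw, rfl⟩
          have := hB ⟨w, hw, rfl⟩
          simp only at this
          linarith
        rw [neg_le, ← min_neg_neg, neg_zero]
        exact min_le_min le_rfl (by linarith)
      · rcases k with k | k
        · rw [hIK k hkI]
          linarith
        · have := (abs_le.1 (hIU k hkI)).1
          linarith

/-- The gap of the problem is at most the gap of any suboptimal basic index set. -/
theorem gap_le {P : Problem d K U} {xs : Vec d} {I : Finset (Idx K U)} (hI : I.card = d)
    (hs : ¬ P.Associated I xs) :
    P.gap xs ≤ max (P.effGap xs I) (max (P.feasGap I) (P.conGap I)) := by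
  refine csInf_le (Set.Finite.bddBelow ?_) ⟨I, hI, hs, rfl⟩
  refine (Set.finite_range fun I : Finset (Idx K U) =>
    max (P.effGap xs I) (max (P.feasGap I) (P.conGap I))).subset ?_
  rintro _ ⟨I, -, -, rfl⟩
  exact ⟨I, rfl⟩

end Problem

/-! ### Vertices and the optimal basis -/

/-- A direction that is nonpositive on the active constraints is feasible for small steps. -/
theorem eventually_feasible {ι : Type*} [Finite ι] {b : ι → Vec d} {β : ι → ℝ} {x u : Vec d}
    (hx : ∀ i, ⟪b i, x⟫ ≤ β i) (hu : ∀ i, ⟪b i, x⟫ = β i → ⟪b i, u⟫ ≤ 0) :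
    ∀ᶠ ε : ℝ in nhdsWithin 0 (Set.Ioi 0), ∀ i, ⟪b i, x + ε • u⟫ ≤ β i := by
  rw [Filter.eventually_all]
  intro i
  rcases (hx i).eq_or_lt with h | h
  · filter_upwards [self_mem_nhdsWithin] with ε hε
    rw [inner_add_right, inner_smul_right, h]
    linarith [mul_nonpos_of_nonneg_of_nonpos (le_of_lt hε) (hu i h)]
  · have hc : Continuous fun ε : ℝ => ⟪b i, x + ε • u⟫ := by fun_prop
    have h0 : (fun ε : ℝ => ⟪b i, x + ε • u⟫) 0 < β i := by simpa using h
    exact ((hc.tendsto 0).eventually_lt_const h0 |>.mono fun _ h => h.le).filter_mono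
      nhdsWithin_le_nhds

/-- At a vertex of a polyhedron in `ℝ^d` there are `d` linearly independent active constraints. -/
theorem exists_active_basis {ι : Type*} [Fintype ι] {b : ι → Vec d} {β : ι → ℝ} {x : Vec d}
    (hx : ∀ i, ⟪b i, x⟫ ≤ β i)
    (hext : ∀ u, (∀ i, ⟪b i, x + u⟫ ≤ β i) → (∀ i, ⟪b i, x - u⟫ ≤ β i) → u = 0) :
    ∃ I : Finset ι, I.card = d ∧ LinearIndependent ℝ (fun i : I => b i) ∧
      ∀ i ∈ I, ⟪b i, x⟫ = β i := by
  classical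
  set t : Set ι := {i | ⟪b i, x⟫ = β i} with ht
  -- A vector orthogonal to all active constraints allows small moves in both directions, which a
  -- vertex forbids.
  have hspan : Submodule.span ℝ (b '' t) = ⊤ := by
    rw [← Submodule.orthogonal_eq_bot_iff, Submodule.eq_bot_iff]
    intro u hu
    have hu' : ∀ i, ⟪b i, x⟫ = β i → ⟪b i, u⟫ = 0 := fun i hi =>
      hu _ (Submodule.subset_span ⟨i, hi, rfl⟩)
    have h1 := eventually_feasible hx (u := u) fun i hi => (hu' i hi).le
    have h2 := eventually_feasible hx (u := -u) fun i hi => by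
      rw [inner_neg_right, hu' i hi, neg_zero]
    obtain ⟨ε, ⟨h1, h2⟩, hε⟩ := ((h1.and h2).and self_mem_nhdsWithin).exists
    have := hext (ε • u) h1 (by simpa [sub_eq_add_neg] using h2)
    exact (smul_eq_zero.1 this).resolve_left (ne_of_gt hε)
  obtain ⟨I, hIt, -, htI, hI⟩ := exists_linearIndepOn_extension
    (linearIndepOn_empty ℝ b) (Set.empty_subset t)
  have htop : Submodule.span ℝ (b '' I) = ⊤ := by
    rw [eq_top_iff, ← hspan]
    exact Submodule.span_le.2 htI
  have hI' : LinearIndependent ℝ (fun i : I.toFinset => b i) := by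
    have : LinearIndepOn ℝ b (I.toFinset : Set ι) := by rwa [Set.coe_toFinset]
    exact this
  refine ⟨I.toFinset, ?_, hI', fun i hi => hIt (Set.mem_toFinset.1 hi)⟩
  have h1 := finrank_span_eq_card hI'
  have h2 : Set.range (fun i : I.toFinset => b i) = b '' I := by
    ext v; simp
  rw [h2, htop, finrank_top, finrank_euclideanSpace_fin, Fintype.card_coe] at h1
  exact h1.symm

namespace Problem

theorem mem_feasibleSet_iff {P : Problem d K U} (hP : P.IsPolytopal) {x : Vec d} :
    x ∈ P.feasibleSet ↔ ∀ i, ⟪P.a i, x⟫ ≤ P.α i := by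
  unfold feasibleSet
  rw [hP]
  simp [Sum.forall]

/-- An optimal basic index set is the set of active constraints of the optimum. -/
theorem mem_of_active {P : Problem d K U} (hP : P.IsPolytopal) (hN : P.IsNondegenerate)
    {xs : Vec d} (hxs : P.IsUniqueOptimum xs) {I : Finset (Idx K U)} (hI : I.card = d)
    (hIs : P.Associated I xs) {i : Idx K U} (hi : ⟪P.a i, xs⟫ = P.α i) : i ∈ I := by
  have hfeas := (mem_feasibleSet_iff hP).1 hxs.1
  obtain ⟨I₀, hc, hli, hact⟩ := exists_active_basis hfeas (by
    intro u h1 h2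
    by_contra hu
    have h3 := hxs.2 _ ((mem_feasibleSet_iff hP).2 h1) (by simpa using hu)
    have h4 := hxs.2 _ ((mem_feasibleSet_iff hP).2 h2) (by simpa using hu)
    rw [inner_add_right] at h3
    rw [inner_sub_right] at h4
    linarith)
  -- The vectors of `I` need not be independent, so non-degeneracy is applied to the independent set
  -- `I₀` obtained from the optimum being a vertex. Cardinality then gives `I = I₀`.
  have hall := hN xs hfeas I₀ hc hli hact
  have hsub : I ⊆ I₀ := fun j hj => hall j (hIs.2 j hj)
  rw [Finset.eq_of_subset_of_card_le hsub (by rw [hc, hI])]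
  exact hall i hi

/-- The objective is a nonnegative combination of the constraint vectors of an optimal basic index
set. -/
theorem exists_objective_eq_sum {P : Problem d K U} (hP : P.IsPolytopal)
    (hN : P.IsNondegenerate) {xs : Vec d} (hxs : P.IsUniqueOptimum xs) {I : Finset (Idx K U)}
    (hI : I.card = d) (hIs : P.Associated I xs) :
    ∃ y : Idx K U → ℝ, (∀ i ∈ I, 0 ≤ y i) ∧ P.θ = ∑ i ∈ I, y i • P.a i := by
  classical
  -- Since `I` contains all active constraints, a small step along such a `u` stays feasible; `⟪θ,
  -- u⟫ > 0` would improve on the optimum.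
  refine farkas_inner I P.a P.θ fun u hu => ?_
  obtain ⟨ε, h1, hε⟩ := ((eventually_feasible ((mem_feasibleSet_iff hP).1 hxs.1) (u := u)
    fun i hi => hu i (mem_of_active hP hN hxs hI hIs hi)).and self_mem_nhdsWithin).exists
  by_contra! hpos
  have hne : xs + ε • u ≠ xs := by
    intro h
    have : u = 0 := by simpa [(ne_of_gt hε : ε ≠ 0)] using h
    simp [this] at hpos
  have := hxs.2 _ ((mem_feasibleSet_iff hP).2 h1) hne
  rw [inner_add_right, inner_smul_right] at this
  have : 0 < ε * ⟪P.θ, u⟫ := mul_pos hε hpos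
  linarith

end Problem

/-! ### Optimistic play over ellipsoids -/

section Ellipsoid

variable {B : Vec d ≃ₗ[ℝ] Vec d} {D : Vec d →ₗ[ℝ] Vec d} {r : ℝ}

/-- `D` is the inverse transpose of `B`, so this is Cauchy–Schwarz for the ellipsoid norm and its
dual norm. -/
theorem abs_inner_sub_le_of_ellipsoid (hBD : ∀ u z, ⟪B u, D z⟫ = ⟪u, z⟫) {c v : Vec d}
    (hv : ‖B (v - c)‖ ≤ r) (z : Vec d) : |⟪v, z⟫ - ⟪c, z⟫| ≤ r * ‖D z‖ := by
  rw [← inner_sub_left, ← hBD]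
  exact (abs_real_inner_le_norm _ _).trans (mul_le_mul_of_nonneg_right hv (norm_nonneg _))

theorem abs_inner_sub_inner_le_of_ellipsoid (hBD : ∀ u z, ⟪B u, D z⟫ = ⟪u, z⟫) {c v w : Vec d}
    (hv : ‖B (v - c)‖ ≤ r) (hw : ‖B (w - c)‖ ≤ r) (z : Vec d) :
    |⟪v, z⟫ - ⟪w, z⟫| ≤ 2 * (r * ‖D z‖) := by
  have h1 := abs_le.1 (abs_inner_sub_le_of_ellipsoid hBD hv z)
  have h2 := abs_le.1 (abs_inner_sub_le_of_ellipsoid hBD hw z)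
  rw [abs_le]
  constructor <;> linarith

/-- The choices `s = 1` and `s = -1` give the extreme values of `⟪·, z⟫` on the ellipsoid, attained
by moving from the centre along `B⁻¹ D z`. -/
theorem exists_mem_ellipsoid_inner_eq (hBD : ∀ u z, ⟪B u, D z⟫ = ⟪u, z⟫) (hr : 0 ≤ r)
    (c z : Vec d) {s : ℝ} (hs : |s| ≤ 1) :
    ∃ v, ‖B (v - c)‖ ≤ r ∧ ⟪v, z⟫ = ⟪c, z⟫ + s * (r * ‖D z‖) := by
  refine ⟨c + (s * (r / ‖D z‖)) • B.symm (D z), ?_, ?_⟩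
  · rw [add_sub_cancel_left, map_smul, B.apply_symm_apply, norm_smul, Real.norm_eq_abs, abs_mul,
      abs_of_nonneg (by positivity : 0 ≤ r / ‖D z‖), mul_assoc]
    calc |s| * (r / ‖D z‖ * ‖D z‖) ≤ 1 * r := by
          refine mul_le_mul hs ?_ (by positivity) zero_le_one
          rcases eq_or_ne ‖D z‖ 0 with h | h
          · simpa [h] using hr
          · rw [div_mul_cancel₀ _ h]
      _ = r := one_mul r
  · rw [inner_add_left, real_inner_smul_left, ← hBD (B.symm (D z)), B.apply_symm_apply,
      real_inner_self_eq_norm_sq]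
    rcases eq_or_ne ‖D z‖ 0 with h | h
    · simp [h]
    · field_simp

/-- The optimistic value `⟪c, z⟫ + r ‖D z‖` is strictly convex except along rays: if it does
not exceed its value at `x` at both `x + u` and `x - u`, then it is constant there, and `u = 0`
unless this value is zero. -/
theorem optimistic_value_eq (hD : Function.Injective D) (hr : 0 < r) {c x u : Vec d}
    (h1 : ⟪c, x + u⟫ + r * ‖D (x + u)‖ ≤ ⟪c, x⟫ + r * ‖D x‖)
    (h2 : ⟪c, x - u⟫ + r * ‖D (x - u)‖ ≤ ⟪c, x⟫ + r * ‖D x‖) :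
    ⟪c, x + u⟫ + r * ‖D (x + u)‖ = ⟪c, x⟫ + r * ‖D x‖ ∧
    ⟪c, x - u⟫ + r * ‖D (x - u)‖ = ⟪c, x⟫ + r * ‖D x‖ ∧
    (⟪c, x⟫ + r * ‖D x‖ ≠ 0 → u = 0) := by
  have hsum : D (x + u) + D (x - u) = (2 : ℝ) • D x := by
    rw [← map_add, ← map_smul]
    congr 1
    rw [two_smul]
    abel
  have hn : ‖D (x + u) + D (x - u)‖ = 2 * ‖D x‖ := by
    rw [hsum, norm_smul]
    simp
  have htri := norm_add_le (D (x + u)) (D (x - u))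
  have hlin : ⟪c, x + u⟫ + ⟪c, x - u⟫ = 2 * ⟪c, x⟫ := by
    rw [inner_add_right, inner_sub_right]
    ring
  rw [hn] at htri
  have hmul := mul_le_mul_of_nonneg_left htri hr.le
  have e1 : ⟪c, x + u⟫ + r * ‖D (x + u)‖ = ⟪c, x⟫ + r * ‖D x‖ := by linarith
  have e2 : ⟪c, x - u⟫ + r * ‖D (x - u)‖ = ⟪c, x⟫ + r * ‖D x‖ := by linarith
  refine ⟨e1, e2, fun hne => ?_⟩
  -- This is the equality case of the triangle inequality. The optimistic value is positively
  -- homogeneous, so two points of one ray with the same nonzero value coincide.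
  have hray : SameRay ℝ (D (x + u)) (D (x - u)) := by
    rw [sameRay_iff_norm_add, hn]
    refine le_antisymm htri (le_of_mul_le_mul_left ?_ hr)
    linarith
  rw [hD.sameRay_map_iff] at hray
  rcases hray with h | h | ⟨r₁, r₂, hr₁, hr₂, h⟩
  · rw [h] at e1
    simp at e1
    exact absurd e1.symm hne
  · rw [h] at e2
    simp at e2
    exact absurd e2.symm hne
  · have h3 : r₁ * (⟪c, x + u⟫ + r * ‖D (x + u)‖) = r₂ * (⟪c, x - u⟫ + r * ‖D (x - u)‖) := by
      have i1 : r₁ * ⟪c, x + u⟫ = r₂ * ⟪c, x - u⟫ := by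
        rw [← inner_smul_right, ← inner_smul_right, h]
      have i2 : r₁ * ‖D (x + u)‖ = r₂ * ‖D (x - u)‖ := by
        have := congrArg (fun z => ‖D z‖) h
        simpa only [map_smul, norm_smul, Real.norm_eq_abs, abs_of_pos hr₁, abs_of_pos hr₂]
          using this
      linear_combination i1 + r * i2
    rw [e1, e2] at h3
    have h4 : r₁ = r₂ := mul_right_cancel₀ hne h3
    rw [h4] at h
    have h5 := smul_right_injective _ hr₂.ne' h
    have h6 : (2 : ℝ) • u = 0 := by
      rw [two_smul]
      have : x + u - (x - u) = 0 := sub_eq_zero.2 h5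
      calc u + u = x + u - (x - u) := by abel
        _ = 0 := this
    simpa using h6

/-! ### One round of optimistic play -/

namespace Problem

/-- One round of doubly optimistic play when the true parameters lie in the confidence sets. -/
theorem round_bounds {P : Problem d K U} (hP : P.IsPolytopal) (hN : P.IsNondegenerate)
    {xs : Vec d} (hxs : P.IsUniqueOptimum xs)
    (hBD : ∀ u z, ⟪B u, D z⟫ = ⟪u, z⟫) (hD : Function.Injective D) (hr : 0 < r)
    {conf : Idx K U → Set (Vec d)} {c₀ : Vec d} {c : Fin U → Vec d}
    (hconfK : ∀ i, conf (Sum.inl i) = {P.a (Sum.inl i)})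
    (hconfU : ∀ i, conf (Sum.inr i) = {v | ‖B (v - c i)‖ ≤ r})
    (hθ : ‖B (P.θ - c₀)‖ ≤ r) (ha : ∀ i, ‖B (P.a (Sum.inr i) - c i)‖ ≤ r)
    {S C : Set (Vec d)} (hS : S = {z | z ∈ P.knownDomain ∧ ∀ i, ∃ v ∈ conf i, ⟪v, z⟫ ≤ P.α i})
    (hC : C = {v | ‖B (v - c₀)‖ ≤ r}) {x : Vec d}
    (hx : S.Nonempty → ∃ v, (x, v) ∈ optimisticPairs S C ∧
      (⟪v, x⟫ = 0 → x ∈ Set.extremePoints ℝ (Prod.fst '' optimisticPairs S C))) :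
    (∀ i, ⟪P.a i, x⟫ - P.α i ≤ 2 * (r * ‖D x‖)) ∧ ⟪P.θ, xs - x⟫ ≤ 2 * (r * ‖D x‖) ∧
      (0 < ⟪P.θ, xs - x⟫ → P.gap xs ≤ 2 * (r * ‖D x‖)) := by
  have hρ : 0 ≤ 2 * (r * ‖D x‖) := by positivity
  have hmem : ∀ i, P.a i ∈ conf i := by
    rintro (i | i)
    · rw [hconfK]; rfl
    · rw [hconfU]; exact ha i
  have hxsS : xs ∈ S := by
    rw [hS]
    exact ⟨hxs.1.1, fun i => ⟨P.a i, hmem i, (mem_feasibleSet_iff hP).1 hxs.1 i⟩⟩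
  obtain ⟨v, ⟨hxS, hvC, hmax⟩, htie⟩ := hx ⟨xs, hxsS⟩
  simp only at hxS hvC hmax
  have hvC' : ‖B (v - c₀)‖ ≤ r := by rw [hC] at hvC; exact hvC
  have hxS' := hxS
  rw [hS] at hxS'
  have hKx : ∀ i, ⟪P.a (Sum.inl i), x⟫ ≤ P.α (Sum.inl i) := hxS'.1.2
  have hviol : ∀ i, ⟪P.a i, x⟫ - P.α i ≤ 2 * (r * ‖D x‖) := by
    rintro (i | i)
    · linarith [hKx i]
    · obtain ⟨w, hw, hwx⟩ := hxS'.2 (Sum.inr i)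
      rw [hconfU] at hw
      have := (abs_le.1 (abs_inner_sub_inner_le_of_ellipsoid hBD (ha i) hw x)).2
      linarith
  have hopt : ⟪P.θ, xs - x⟫ ≤ 2 * (r * ‖D x‖) := by
    have h1 := hmax xs hxsS P.θ (by rw [hC]; exact hθ)
    have h2 := (abs_le.1 (abs_inner_sub_inner_le_of_ellipsoid hBD hvC' hθ x)).2
    rw [inner_sub_right]
    linarith
  refine ⟨hviol, hopt, fun hpos => ?_⟩
  -- the least optimistic constraint vectors that permit `x`
  choose lo hlo hlox using fun i : Fin U =>
    exists_mem_ellipsoid_inner_eq hBD hr.le (c i) x (s := -1) (by simp)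
  have hlo_le : ∀ i w, ‖B (w - c i)‖ ≤ r → ⟪lo i, x⟫ ≤ ⟪w, x⟫ := by
    intro i w hw
    have := (abs_le.1 (abs_inner_sub_le_of_ellipsoid hBD hw x)).1
    rw [hlox]
    linarith
  let b : Idx K U → Vec d := Sum.elim (fun i => P.a (Sum.inl i)) lo
  have hbconf : ∀ i, b i ∈ conf i := by
    rintro (i | i)
    · rw [hconfK]; rfl
    · rw [hconfU]; exact hlo i
  -- The permissible set need not be a polyhedron; freezing the constraint vectors at `b` gives a
  -- polyhedron inside it that still contains `x`.
  have hbS : ∀ z, (∀ i, ⟪b i, z⟫ ≤ P.α i) → z ∈ S := by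
    intro z hz
    rw [hS]
    refine ⟨?_, fun i => ⟨b i, hbconf i, hz i⟩⟩
    rw [hP]
    exact fun i => hz (Sum.inl i)
  have hbx : ∀ i, ⟪b i, x⟫ ≤ P.α i := by
    rintro (i | i)
    · exact hKx i
    · obtain ⟨w, hw, hwx⟩ := hxS'.2 (Sum.inr i)
      rw [hconfU] at hw
      exact (hlo_le i w hw).trans hwx
  have hval : ∀ z ∈ S, ⟪c₀, z⟫ + r * ‖D z‖ ≤ ⟪v, x⟫ := by
    intro z hz
    obtain ⟨w, hw, hwz⟩ := exists_mem_ellipsoid_inner_eq hBD hr.le c₀ z (s := 1) (by simp)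
    have := hmax z hz w (by rw [hC]; exact hw)
    linarith
  have hvx : ⟪v, x⟫ = ⟪c₀, x⟫ + r * ‖D x‖ := by
    refine le_antisymm ?_ (hval x hxS)
    have := (abs_le.1 (abs_inner_sub_le_of_ellipsoid hBD hvC' x)).2
    linarith
  have hfst : ∀ z ∈ S, ⟪c₀, z⟫ + r * ‖D z‖ = ⟪c₀, x⟫ + r * ‖D x‖ →
      z ∈ Prod.fst '' optimisticPairs S C := by
    intro z hz hzx
    obtain ⟨w, hw, hwz⟩ := exists_mem_ellipsoid_inner_eq hBD hr.le c₀ z (s := 1) (by simp)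
    refine ⟨(z, w), ⟨hz, by rw [hC]; exact hw, fun z' hz' w' hw' => ?_⟩, rfl⟩
    have := hmax z' hz' w' hw'
    simp only
    linarith
  -- If `x ± u` both satisfy the frozen constraints, neither exceeds the maximal value at `x`, so
  -- both attain it. A nonzero value forces `u = 0` by strict convexity off rays; for value zero the
  -- tie rule excludes `x` as a midpoint of optimal actions.
  obtain ⟨I, hI, -, hact⟩ := exists_active_basis hbx (by
    intro u hu1 hu2
    have hS1 := hbS _ hu1
    have hS2 := hbS _ hu2
    obtain ⟨e1, e2, hne⟩ := optimistic_value_eq hD hr (c := c₀)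
      ((hval _ hS1).trans hvx.le) ((hval _ hS2).trans hvx.le)
    by_cases h0 : ⟪v, x⟫ = 0
    · have hxe := htie h0
      have hseg : x ∈ openSegment ℝ (x + u) (x - u) := by
        refine ⟨1 / 2, 1 / 2, by norm_num, by norm_num, by norm_num, ?_⟩
        module
      have := hxe.2 (hfst _ hS1 e1) (hfst _ hS2 e2) hseg
      simpa using this
    · exact hne (hvx ▸ h0))
  have hlo_ge : ∀ i, ⟪lo i, x⟫ ≤ ⟪P.a (Sum.inr i), x⟫ := fun i => hlo_le i _ (ha i)
  -- For optimal `I`, an active frozen constraint gives `⟪a i, x⟫ ≥ α i = ⟪a i, xs⟫`. With `θ` in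
  -- the cone of these `a i`, the point `x` is at least as good as `xs`.
  by_cases hIs : P.Associated I xs
  · exfalso
    obtain ⟨y, hy, hθy⟩ := exists_objective_eq_sum hP hN hxs hI hIs
    refine absurd hpos (not_lt.2 ?_)
    rw [hθy, sum_inner]
    refine Finset.sum_nonpos fun i hi => ?_
    rw [real_inner_smul_left]
    refine mul_nonpos_of_nonneg_of_nonpos (hy i hi) ?_
    rw [inner_sub_right, hIs.2 i hi]
    have h1 := hact i hi
    rcases i with i | i
    · simp only [b, Sum.elim_inl] at h1
      linarith
    · simp only [b, Sum.elim_inr] at h1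
      linarith [hlo_ge i]
  · refine (gap_le hI hIs).trans (max_gaps_le hP hρ hKx (fun i hi => hact _ hi) ?_ hviol hopt)
    intro i hi
    have h1 : ⟪lo i, x⟫ = P.α (Sum.inr i) := hact _ hi
    rw [← h1]
    exact abs_inner_sub_inner_le_of_ellipsoid hBD (ha i) (hlo i) x

end Problem

end Ellipsoid

/-! ### The design matrix -/

theorem dotProduct_ofLp_eq_inner (u v : Vec d) : u.ofLp ⬝ᵥ v.ofLp = ⟪u, v⟫ := by
  rw [EuclideanSpace.inner_eq_star_dotProduct, dotProduct_comm]
  simp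

theorem design_zero (lam : ℝ) (x : ℕ → Vec d) :
    design lam x 0 = lam • (1 : Matrix (Fin d) (Fin d) ℝ) := by
  simp [design]

theorem design_succ (lam : ℝ) (x : ℕ → Vec d) (t : ℕ) :
    design lam x (t + 1) = design lam x t + Matrix.vecMulVec (x t).ofLp (x t).ofLp := by
  rw [design, design, Finset.sum_range_succ, add_assoc]

theorem design_mulVec (lam : ℝ) (x : ℕ → Vec d) (t : ℕ) (z : Vec d) :
    (design lam x t).mulVec z.ofLp =
      (lam • z + ∑ τ ∈ Finset.range t, ⟪x τ, z⟫ • x τ).ofLp := by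
  induction t with
  | zero => simp [design_zero, Matrix.smul_mulVec]
  | succ t ih =>
    rw [design_succ, Matrix.add_mulVec, ih, Finset.sum_range_succ, ← add_assoc,
      Matrix.vecMulVec_mulVec, dotProduct_ofLp_eq_inner]
    ext i
    simp [mul_comm]

theorem dotProduct_design_mulVec (lam : ℝ) (x : ℕ → Vec d) (t : ℕ) (z : Vec d) :
    z.ofLp ⬝ᵥ (design lam x t).mulVec z.ofLp =
      lam * ‖z‖ ^ 2 + ∑ τ ∈ Finset.range t, ⟪x τ, z⟫ ^ 2 := by
  rw [design_mulVec, dotProduct_ofLp_eq_inner, inner_add_right, inner_smul_right,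
    real_inner_self_eq_norm_sq, inner_sum]
  congr 1
  refine Finset.sum_congr rfl fun τ _ => ?_
  rw [inner_smul_right, real_inner_comm z (x τ)]
  ring

theorem design_isHermitian (lam : ℝ) (x : ℕ → Vec d) (t : ℕ) :
    (design lam x t).IsHermitian := by
  induction t with
  | zero =>
    rw [design_zero]
    simp [Matrix.IsHermitian]
  | succ t ih =>
    rw [design_succ]
    refine ih.add ?_
    simp [Matrix.IsHermitian]

theorem design_posDef {lam : ℝ} (hlam : 0 < lam) (x : ℕ → Vec d) (t : ℕ) :
    (design lam x t).PosDef := by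
  refine .of_dotProduct_mulVec_pos (design_isHermitian lam x t) fun z hz => ?_
  have h := dotProduct_design_mulVec lam x t (WithLp.toLp 2 z)
  simp only [star_trivial]
  simp only at h
  rw [h]
  have hz' : WithLp.toLp 2 z ≠ (0 : Vec d) := fun h0 => hz (by simpa using congrArg WithLp.ofLp h0)
  have h1 : 0 < ‖WithLp.toLp 2 z‖ := norm_pos_iff.2 hz'
  have h2 : 0 ≤ ∑ τ ∈ Finset.range t, ⟪x τ, WithLp.toLp 2 z⟫ ^ 2 := by positivity
  positivity

/-- A positive definite matrix is `Bᵀ B` with `B` invertible; `D` is the inverse transpose. -/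
theorem exists_factorization {V : Matrix (Fin d) (Fin d) ℝ} (hV : V.PosDef) :
    ∃ (B : Vec d ≃ₗ[ℝ] Vec d) (D : Vec d →ₗ[ℝ] Vec d),
      (∀ z, matNorm V z = ‖B z‖) ∧ (∀ u z, ⟪B u, D z⟫ = ⟪u, z⟫) ∧ Function.Injective D ∧
      (∀ z, B (WithLp.toLp 2 (V⁻¹.mulVec z.ofLp)) = D z) ∧ (∀ z, matNorm V⁻¹ z = ‖D z‖) ∧
      |LinearMap.det (B : Vec d →ₗ[ℝ] Vec d)| = √V.det := by
  open scoped MatrixOrder in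
  obtain ⟨W, hW⟩ := CStarAlgebra.nonneg_iff_eq_star_mul_self.mp hV.posSemidef.nonneg
  have hVdet : V.det = W.det ^ 2 := by
    rw [hW, Matrix.det_mul, Matrix.star_eq_conjTranspose, Matrix.det_conjTranspose, star_trivial,
      sq]
  have hWdet : W.det ≠ 0 := by
    intro h
    have := hV.det_pos
    rw [hVdet, h] at this
    simp at this
  have hB₀det : LinearMap.det (Matrix.toLpLin 2 2 W) = W.det := LinearMap.det_toLpLin 2 W
  let B : Vec d ≃ₗ[ℝ] Vec d :=
    LinearMap.equivOfDetNeZero (Matrix.toLpLin 2 2 W) (by rwa [hB₀det])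
  have hB : ∀ z, B z = WithLp.toLp 2 (W.mulVec z.ofLp) := fun z => rfl
  have hBB : ∀ u w : Vec d, ⟪B u, B w⟫ = u.ofLp ⬝ᵥ V.mulVec w.ofLp := by
    intro u w
    rw [hB, hB, ← dotProduct_ofLp_eq_inner, hW, ← Matrix.mulVec_mulVec,
      Matrix.dotProduct_mulVec u.ofLp, Matrix.star_eq_conjTranspose, Matrix.vecMul_conjTranspose]
    simp
  let D : Vec d →ₗ[ℝ] Vec d := LinearMap.adjoint (B.symm : Vec d →ₗ[ℝ] Vec d)
  have hBD : ∀ u z, ⟪B u, D z⟫ = ⟪u, z⟫ := by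
    intro u z
    rw [LinearMap.adjoint_inner_right]
    simp
  have hBV : ∀ z : Vec d, B (WithLp.toLp 2 (V⁻¹.mulVec z.ofLp)) = D z := by
    intro z
    refine ext_inner_left ℝ fun w => ?_
    obtain ⟨u, rfl⟩ := B.surjective w
    rw [hBB, hBD, Matrix.mulVec_mulVec, Matrix.mul_nonsing_inv _ hV.det_pos.ne'.isUnit,
      Matrix.one_mulVec, dotProduct_ofLp_eq_inner]
  refine ⟨B, D, fun z => ?_, hBD, ?_, hBV, fun z => ?_, ?_⟩
  · rw [matNorm, ← hBB, real_inner_self_eq_norm_sq, Real.sqrt_sq (norm_nonneg _)]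
  · refine (injective_iff_map_eq_zero D).2 fun z hz => ?_
    have := hBD z z
    rw [hz, inner_zero_right] at this
    exact inner_self_eq_zero.1 this.symm
  · have h : ‖D z‖ ^ 2 = z.ofLp ⬝ᵥ V⁻¹.mulVec z.ofLp := by
      rw [← real_inner_self_eq_norm_sq, ← hBV z, hBV z]
      nth_rewrite 1 [← hBV z]
      rw [hBD, ← dotProduct_ofLp_eq_inner, dotProduct_comm]
    rw [matNorm, ← h, Real.sqrt_sq (norm_nonneg _)]
  · have h : (B : Vec d →ₗ[ℝ] Vec d) = Matrix.toLpLin 2 2 W := rfl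
    rw [h, hB₀det, hVdet, Real.sqrt_sq_eq_abs]

theorem det_design_zero (lam : ℝ) (x : ℕ → Vec d) : (design lam x 0).det = lam ^ d := by
  rw [design_zero]
  simp

/-- The matrix determinant lemma for a rank-one update. -/
theorem det_design_succ {lam : ℝ} (hlam : 0 < lam) (x : ℕ → Vec d) (t : ℕ) :
    (design lam x (t + 1)).det =
      (design lam x t).det * (1 + matNorm (design lam x t)⁻¹ (x t) ^ 2) := by
  have hV := design_posDef hlam x t
  have hu : IsUnit (design lam x t).det := hV.det_pos.ne'.isUnit
  have hinv := hV.inv.posSemidef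
  rw [design_succ, Matrix.vecMulVec_eq Unit, Matrix.det_add_replicateCol_mul_replicateRow hu]
  congr 1
  rw [Matrix.det_unique, Matrix.add_apply, Matrix.one_apply_eq, matNorm, Real.sq_sqrt]
  · rw [Matrix.mul_assoc, Matrix.dotProduct_mulVec, ← Matrix.mul_assoc]
    rfl
  · simpa using hinv.dotProduct_mulVec_nonneg (x t).ofLp

theorem det_design_pos {lam : ℝ} (hlam : 0 < lam) (x : ℕ → Vec d) (t : ℕ) :
    0 < (design lam x t).det := (design_posDef hlam x t).det_pos

theorem det_design_mono {lam : ℝ} (hlam : 0 < lam) (x : ℕ → Vec d) :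
    Monotone fun t => (design lam x t).det := by
  refine monotone_nat_of_le_succ fun t => ?_
  rw [det_design_succ hlam]
  exact le_mul_of_one_le_right (det_design_pos hlam x t).le 
    (le_add_of_nonneg_right (sq_nonneg _))

/-- Each eigenvalue is the quadratic form at a unit eigenvector, hence at most `lam + t`. -/
theorem det_design_le {lam : ℝ} (hlam : 0 < lam) {x : ℕ → Vec d} (hx : ∀ t, ‖x t‖ ≤ 1) (t : ℕ) :
    (design lam x t).det ≤ (lam + t) ^ d := by
  have hV := design_posDef hlam x t
  rw [hV.isHermitian.det_eq_prod_eigenvalues]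
  have hle : ∀ i, hV.isHermitian.eigenvalues i ≤ lam + t := by
    intro i
    rw [hV.isHermitian.eigenvalues_eq]
    have h1 := hV.isHermitian.eigenvectorBasis.orthonormal.1 i
    simp only [star_trivial, RCLike.re_to_real]
    rw [dotProduct_design_mulVec, h1, one_pow, mul_one]
    refine add_le_add le_rfl ((Finset.sum_le_card_nsmul _ _ 1 fun τ _ => ?_).trans_eq (by simp))
    rw [sq_le_one_iff_abs_le_one]
    exact (abs_real_inner_le_norm _ _).trans (by rw [h1, mul_one]; exact hx τ)
  calc _ ≤ ∏ _i : Fin d, (lam + t) :=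
        Finset.prod_le_prod (fun i _ => (hV.eigenvalues_pos i).le) fun i _ => hle i
    _ = (lam + t) ^ d := by simp

/-- With `u = V⁻¹ z` one has `‖D z‖² = ⟪u, z⟫ ≤ ‖u‖ ‖z‖`, while `V ≥ lam I` gives `lam ‖u‖² ≤ ‖B u‖²
= ‖D z‖²`. -/
theorem sq_matNorm_inv_design_le {lam : ℝ} (hlam : 0 < lam) (x : ℕ → Vec d) (t : ℕ) (z : Vec d) :
    matNorm (design lam x t)⁻¹ z ^ 2 ≤ ‖z‖ ^ 2 / lam := by
  obtain ⟨B, D, hB, hBD, -, hBV, hD, -⟩ := exists_factorization (design_posDef hlam x t)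
  rw [hD]
  set u : Vec d := WithLp.toLp 2 ((design lam x t)⁻¹.mulVec z.ofLp)
  have h1 : ‖D z‖ ^ 2 ≤ ‖u‖ * ‖z‖ := by
    rw [← real_inner_self_eq_norm_sq]
    nth_rewrite 1 [← hBV z]
    rw [hBD]
    exact real_inner_le_norm _ _
  have h2 : lam * ‖u‖ ^ 2 ≤ ‖D z‖ ^ 2 := by
    have h3 : ‖B u‖ ^ 2 = lam * ‖u‖ ^ 2 + ∑ τ ∈ Finset.range t, ⟪x τ, u⟫ ^ 2 := by
      rw [← hB, matNorm, dotProduct_design_mulVec, Real.sq_sqrt (by positivity)]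
    rw [hBV z] at h3
    rw [h3]
    exact le_add_of_nonneg_right (by positivity)
  rw [le_div_iff₀ hlam]
  rcases eq_or_ne ‖D z‖ 0 with h | h
  · simp [h]
  · have h4 : 0 < ‖D z‖ ^ 2 := by positivity
    have h5 : (‖D z‖ ^ 2) ^ 2 ≤ (‖u‖ * ‖z‖) ^ 2 := pow_le_pow_left₀ h4.le h1 2
    refine le_of_mul_le_mul_left ?_ h4
    calc ‖D z‖ ^ 2 * (‖D z‖ ^ 2 * lam) = lam * (‖D z‖ ^ 2) ^ 2 := by ring
      _ ≤ lam * (‖u‖ * ‖z‖) ^ 2 := mul_le_mul_of_nonneg_left h5 hlam.le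
      _ = (lam * ‖u‖ ^ 2) * ‖z‖ ^ 2 := by ring
      _ ≤ ‖D z‖ ^ 2 * ‖z‖ ^ 2 := mul_le_mul_of_nonneg_right h2 (sq_nonneg _)

/-- The elliptical potential bound. -/
theorem sum_sq_width_le {lam : ℝ} (hlam : 0 < lam) {x : ℕ → Vec d} (hx : ∀ t, ‖x t‖ ≤ 1)
    (T : ℕ) :
    ∑ t ∈ Finset.range T, matNorm (design lam x t)⁻¹ (x t) ^ 2 ≤
      (1 + 1 / lam) * Real.log ((design lam x T).det / lam ^ d) := by
  induction T with
  | zero =>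
    rw [det_design_zero, div_self (by positivity)]
    simp
  | succ T ih =>
    set w := matNorm (design lam x T)⁻¹ (x T) ^ 2 with hw
    have hw0 : 0 ≤ w := sq_nonneg _
    have hw1 : w ≤ 1 / lam := (sq_matNorm_inv_design_le hlam x T (x T)).trans
      (div_le_div_of_nonneg_right (pow_le_one₀ (norm_nonneg _) (hx T)) hlam.le)
    have hdet := det_design_pos hlam x T
    rw [Finset.sum_range_succ, det_design_succ hlam, mul_div_right_comm,
      Real.log_mul (by positivity) (by positivity), mul_add]
    refine add_le_add ih ?_
    have h1 := Real.one_sub_inv_le_log_of_pos (by positivity : 0 < 1 + w)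
    -- The factor `1 + 1 / lam` is an upper bound for `1 + w`, because `w ≤ 1 / lam`.
    have h2 : w ≤ (1 + 1 / lam) * (1 - (1 + w)⁻¹) := by
      have h3 : 1 - (1 + w)⁻¹ = w / (1 + w) := by field_simp; ring
      rw [h3, mul_div_assoc', le_div_iff₀ (by positivity)]
      nlinarith
    exact h2.trans (mul_le_mul_of_nonneg_left h1 (by positivity))

/-! ### The method of mixtures -/

/-- Completing the square and translation invariance reduce this to the standard Gaussian integral.
-/
theorem lintegral_gaussian (v : Vec d) :
    ∫⁻ w : Vec d, ENNReal.ofReal (Real.exp (⟪w, v⟫ - ‖w‖ ^ 2 / 2)) =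
      ENNReal.ofReal ((2 * Real.pi) ^ ((d : ℝ) / 2) * Real.exp (‖v‖ ^ 2 / 2)) := by
  have h1 : ∀ w : Vec d, ENNReal.ofReal (Real.exp (⟪w, v⟫ - ‖w‖ ^ 2 / 2)) =
      ENNReal.ofReal (Real.exp (‖v‖ ^ 2 / 2)) *
        ENNReal.ofReal (Real.exp (-(1 / 2) * ‖w - v‖ ^ 2)) := by
    intro w
    rw [← ENNReal.ofReal_mul (Real.exp_pos _).le, ← Real.exp_add, norm_sub_sq_real]
    congr 2
    ring
  have hint : Integrable (fun w : Vec d => Real.exp (-(1 / 2) * ‖w‖ ^ 2)) := by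
    have := (GaussianFourier.integrable_cexp_neg_mul_sq_norm_add (V := Vec d) (b := (1 / 2 : ℂ))
      (by norm_num) 0 0).re
    refine this.congr (Filter.Eventually.of_forall fun w => ?_)
    have : (-(1 / 2 : ℂ) * (‖w‖ : ℂ) ^ 2 + 0 * ((⟪(0 : Vec d), w⟫ : ℝ) : ℂ)) =
      ((-(1 / 2) * ‖w‖ ^ 2 : ℝ) : ℂ) := by push_cast; ring
    simp only [this, ← Complex.ofReal_exp]
    rfl
  simp_rw [h1]
  rw [lintegral_const_mul' _ _ ENNReal.ofReal_ne_top,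
    lintegral_sub_right_eq_self (fun w : Vec d => ENNReal.ofReal (Real.exp (-(1 / 2) * ‖w‖ ^ 2))) v,
    ← ofReal_integral_eq_lintegral_ofReal hint (Filter.Eventually.of_forall fun _ =>
      (Real.exp_pos _).le),
    GaussianFourier.integral_rexp_neg_mul_sq_norm (by norm_num), finrank_euclideanSpace_fin,
    ← ENNReal.ofReal_mul (Real.exp_pos _).le, mul_comm (Real.exp _)]
  congr 4
  field_simp

/-- The exponential process of direction `ξ` driven by actions `x` and noises `η`. -/
def expFactor (x : ℕ → Vec d) (η : ℕ → ℝ) (t : ℕ) (ξ : Vec d) : ℝ :=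
  Real.exp (∑ τ ∈ Finset.range t, (⟪ξ, x τ⟫ * η τ - ⟪ξ, x τ⟫ ^ 2 / 2))

/-- The density of the centred Gaussian law with covariance `lam⁻¹ I`. -/
def gaussDensity (lam : ℝ) (ξ : Vec d) : ℝ :=
  (lam / (2 * Real.pi)) ^ ((d : ℝ) / 2) * Real.exp (-(lam * ‖ξ‖ ^ 2) / 2)

/-- The Gaussian mixture of the exponential processes. -/
def mixture (lam : ℝ) (x : ℕ → Vec d) (η : ℕ → ℝ) (t : ℕ) : ℝ≥0∞ :=
  ∫⁻ ξ : Vec d, ENNReal.ofReal (gaussDensity lam ξ) * ENNReal.ofReal (expFactor x η t ξ)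

/-- The exponents of prior and process add up to `⟪ξ, S⟫ - ‖B ξ‖² / 2`. Substituting `w = B ξ`
leaves a standard Gaussian integral and the Jacobian `(det V)^(-1/2)`. -/
theorem mixture_eq {lam : ℝ} (hlam : 0 < lam) (x : ℕ → Vec d) (η : ℕ → ℝ) (t : ℕ)
    {B : Vec d ≃ₗ[ℝ] Vec d} {D : Vec d →ₗ[ℝ] Vec d}
    (hB : ∀ z, matNorm (design lam x t) z = ‖B z‖) (hBD : ∀ u z, ⟪B u, D z⟫ = ⟪u, z⟫)
    (hdet : |LinearMap.det (B : Vec d →ₗ[ℝ] Vec d)| = √(design lam x t).det) :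
    mixture lam x η t = ENNReal.ofReal (√(lam ^ d) / √(design lam x t).det *
      Real.exp (‖D (∑ τ ∈ Finset.range t, η τ • x τ)‖ ^ 2 / 2)) := by
  set S := ∑ τ ∈ Finset.range t, η τ • x τ with hS
  have hdpos := det_design_pos hlam x t
  have hBsq : ∀ ξ, ‖B ξ‖ ^ 2 = lam * ‖ξ‖ ^ 2 + ∑ τ ∈ Finset.range t, ⟪x τ, ξ⟫ ^ 2 := by
    intro ξ
    rw [← hB, matNorm, dotProduct_design_mulVec, Real.sq_sqrt (by positivity)]
  have h1 : ∀ ξ : Vec d, ENNReal.ofReal (gaussDensity lam ξ) *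
      ENNReal.ofReal (expFactor x η t ξ) =
      ENNReal.ofReal ((lam / (2 * Real.pi)) ^ ((d : ℝ) / 2)) *
        ENNReal.ofReal (Real.exp (⟪B ξ, D S⟫ - ‖B ξ‖ ^ 2 / 2)) := by
    intro ξ
    rw [gaussDensity, ENNReal.ofReal_mul (by positivity), mul_assoc,
      ← ENNReal.ofReal_mul (Real.exp_pos _).le, expFactor, ← Real.exp_add, hBD, hBsq, hS,
      inner_sum, add_div, Finset.sum_div, Finset.sum_sub_distrib]
    congr 3
    have h2 : ∀ τ, ⟪ξ, η τ • x τ⟫ = ⟪ξ, x τ⟫ * η τ := fun τ => by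
      rw [inner_smul_right, mul_comm]
    have h3 : ∀ τ, ⟪x τ, ξ⟫ = ⟪ξ, x τ⟫ := fun τ => real_inner_comm _ _
    simp only [h2, h3]
    ring
  have hBc : Continuous (B : Vec d →ₗ[ℝ] Vec d) := LinearMap.continuous_of_finiteDimensional _
  have hdet0 : LinearMap.det (B : Vec d →ₗ[ℝ] Vec d) ≠ 0 := by
    rw [← abs_pos, hdet]
    positivity
  have h4 : ∫⁻ ξ : Vec d, ENNReal.ofReal (Real.exp (⟪B ξ, D S⟫ - ‖B ξ‖ ^ 2 / 2)) =
      ENNReal.ofReal (√(design lam x t).det)⁻¹ *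
      ENNReal.ofReal ((2 * Real.pi) ^ ((d : ℝ) / 2) * Real.exp (‖D S‖ ^ 2 / 2)) := by
    rw [← lintegral_gaussian, ← hdet, ← abs_inv, ← smul_eq_mul, ← lintegral_smul_measure,
      ← Measure.map_linearMap_addHaar_eq_smul_addHaar volume hdet0, lintegral_map]
    · rfl
    · fun_prop
    · exact hBc.measurable
  rw [mixture]
  simp_rw [h1]
  rw [lintegral_const_mul' _ _ ENNReal.ofReal_ne_top, h4, ← ENNReal.ofReal_mul (by positivity),
    ← ENNReal.ofReal_mul (by positivity)]
  congr 1
  have h5 : (lam / (2 * Real.pi)) ^ ((d : ℝ) / 2) * (2 * Real.pi) ^ ((d : ℝ) / 2) =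
      √(lam ^ d) := by
    rw [← Real.mul_rpow (by positivity) (by positivity), div_mul_cancel₀ _ (by positivity),
      Real.sqrt_eq_rpow, ← Real.rpow_natCast, ← Real.rpow_mul hlam.le]
    congr 1
    ring
  rw [← h5]
  ring

theorem mixture_zero {lam : ℝ} (hlam : 0 < lam) (x : ℕ → Vec d) (η : ℕ → ℝ) :
    mixture lam x η 0 = 1 := by
  obtain ⟨B, D, hB, hBD, -, -, -, hdet⟩ := exists_factorization (design_posDef hlam x 0)
  rw [mixture_eq hlam x η 0 hB hBD hdet, det_design_zero, div_self (by positivity)]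
  simp

/-- The self-normalised bound: where the mixture process is small, the true parameter lies in the
confidence ellipsoid. -/
theorem mem_ellipsoid_of_mixture_lt {lam δ : ℝ} (hlam : 0 < lam) (hδ : 0 < δ) {θ : Vec d}
    (hθ : ‖θ‖ ≤ 1) (x : ℕ → Vec d) (η y : ℕ → ℝ) (hy : ∀ τ, y τ = ⟪θ, x τ⟫ + η τ) (t : ℕ)
    (hlt : mixture lam x η t < ENNReal.ofReal (((U : ℝ) + 1) / δ)) :
    θ ∈ ellipsoid U lam δ x y t := by
  obtain ⟨B, D, hB, hBD, -, hBV, hD, hdet⟩ := exists_factorization (design_posDef hlam x t)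
  have hdpos := det_design_pos hlam x t
  set S := ∑ τ ∈ Finset.range t, η τ • x τ with hS
  rw [mixture_eq hlam x η t hB hBD hdet, ENNReal.ofReal_lt_ofReal_iff (by positivity)] at hlt
  -- The error splits into the noise `S` and the regularisation bias `lam • θ`; they account for the
  -- two summands of the radius.
  have hest : estimate lam x y t - θ =
      WithLp.toLp 2 ((design lam x t)⁻¹.mulVec (S - lam • θ).ofLp) := by
    have h1 : S - lam • θ = (∑ τ ∈ Finset.range t, y τ • x τ) -
        WithLp.toLp 2 ((design lam x t).mulVec θ.ofLp) := by
      rw [design_mulVec, WithLp.toLp_ofLp, sub_add_eq_sub_sub_swap, ← Finset.sum_sub_distrib]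
      congr 1
      refine Finset.sum_congr rfl fun τ _ => ?_
      rw [← sub_smul, hy, real_inner_comm]
      congr 1
      ring
    rw [h1, WithLp.ofLp_sub, Matrix.mulVec_sub, WithLp.toLp_sub, Matrix.mulVec_mulVec,
      Matrix.nonsing_inv_mul _ hdpos.ne'.isUnit, Matrix.one_mulVec, WithLp.toLp_ofLp, estimate,
      WithLp.ofLp_sum]
    rfl
  have hDθ : ‖D θ‖ ≤ 1 / √lam := by
    have h1 := sq_matNorm_inv_design_le hlam x t θ
    rw [hD] at h1
    refine abs_le_of_sq_le_sq' ?_ (by positivity) |>.2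
    rw [div_pow, one_pow, Real.sq_sqrt hlam.le]
    exact h1.trans (div_le_div_of_nonneg_right (pow_le_one₀ (norm_nonneg _) hθ) hlam.le)
  have hDS : ‖D S‖ ≤ √(2 * Real.log (((U : ℝ) + 1) * √(design lam x t).det /
      √(lam • (1 : Matrix (Fin d) (Fin d) ℝ)).det / δ)) := by
    refine Real.le_sqrt_of_sq_le ?_
    have h0 : (lam • (1 : Matrix (Fin d) (Fin d) ℝ)).det = lam ^ d := by simp
    rw [h0]
    have h1 : Real.exp (‖D S‖ ^ 2 / 2) ≤
        ((U : ℝ) + 1) * √(design lam x t).det / √(lam ^ d) / δ := by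
      rw [div_mul_eq_mul_div, div_lt_div_iff₀ (by positivity) hδ] at hlt
      rw [div_div, le_div_iff₀ (by positivity)]
      linarith
    have h2 := (Real.le_log_iff_exp_le (by positivity)).2 h1
    linarith
  have hlamS : lam * (1 / √lam) = √lam := by
    rw [mul_one_div, Real.div_sqrt]
  rw [ellipsoid, Set.mem_ofPred_eq, hB, map_sub, norm_sub_rev, ← map_sub, hest, hBV, map_sub,
    map_smul, radius]
  refine (norm_sub_le _ _).trans (add_le_add hDS ?_)
  rw [norm_smul, Real.norm_eq_abs, abs_of_pos hlam, ← hlamS]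
  exact mul_le_mul_of_nonneg_left hDθ hlam.le

/-! ### Nonnegative supermartingales -/

section Supermartingale

variable {Ω : Type*}

/-- **Ville's inequality** for a nonnegative supermartingale. -/
theorem ville {m₀ : MeasurableSpace Ω} (μ : Measure Ω) {F : ℕ → MeasurableSpace Ω}
    (hmono : Monotone F) (hle : ∀ t, F t ≤ m₀) {N : ℕ → Ω → ℝ≥0∞}
    (hN : ∀ t, Measurable[F t] (N t))
    (hstep : ∀ t A, MeasurableSet[F t] A → ∫⁻ ω in A, N (t + 1) ω ∂μ ≤ ∫⁻ ω in A, N t ω ∂μ)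
    (h0 : ∫⁻ ω, N 0 ω ∂μ ≤ 1) (c : ℝ≥0∞) : c * μ {ω | ∃ t, c ≤ N t ω} ≤ 1 := by
  let G : ℕ → Set Ω := fun t => {ω | c ≤ N t ω}
  let E : ℕ → Set Ω := fun n => ⋃ t ∈ Finset.range (n + 1), G t
  have hG : ∀ t, MeasurableSet[F t] (G t) := fun t =>
    hN t measurableSet_Ici
  have hE : ∀ n, MeasurableSet[F n] (E n) := fun n =>
    @Finset.measurableSet_biUnion _ _ (F n) _ _ fun t ht =>
      hmono (Nat.lt_succ_iff.1 (Finset.mem_range.1 ht)) _ (hG t)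
  have hG' : ∀ t, MeasurableSet (G t) := fun t => hle t _ (hG t)
  have hE' : ∀ t, MeasurableSet (E t) := fun t => hle t _ (hE t)
  have hEsucc : ∀ n, E (n + 1) = E n ∪ G (n + 1) := by
    intro n
    simp only [E]
    rw [Finset.range_add_one (n := n + 1), Finset.set_biUnion_insert, Set.union_comm]
  have hNm : ∀ t, Measurable (N t) := fun t => (hN t).mono (hle t) le_rfl
  have hcG : ∀ t (A : Set Ω), MeasurableSet A → c * μ (A ∩ G t) ≤ ∫⁻ ω in A ∩ G t, N t ω ∂μ := by
    intro t A hA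
    rw [← setLIntegral_const]
    exact setLIntegral_mono (hNm t) fun ω hω => hω.2
  -- This is the process stopped at its first passage above `c`: paths that have crossed are counted
  -- with value `c`, the others with their current value.
  have key : ∀ n, c * μ (E n) + ∫⁻ ω in (E n)ᶜ, N n ω ∂μ ≤ 1 := by
    intro n
    induction n with
    | zero =>
      have : E 0 = G 0 := by simp [E]
      rw [this]
      refine le_trans (le_of_le_of_eq ?_ (lintegral_add_compl (N 0) (hG' 0))) h0
      have := hcG 0 Set.univ MeasurableSet.univ
      rw [Set.univ_inter] at this
      exact add_le_add this le_rfl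
    | succ n ih =>
      refine le_trans ?_ ih
      have h1 : E (n + 1) = E n ∪ ((E n)ᶜ ∩ G (n + 1)) := by
        rw [hEsucc]
        ext ω
        simp only [Set.mem_union, Set.mem_inter_iff, Set.mem_compl_iff]
        tauto
      have h2 : μ (E (n + 1)) ≤ μ (E n) + μ ((E n)ᶜ ∩ G (n + 1)) := by
        rw [h1]
        exact measure_union_le _ _
      have h3 : (E (n + 1))ᶜ = (E n)ᶜ \ G (n + 1) := by
        rw [hEsucc, Set.compl_union]
        rfl
      have h4 := hstep n (E n)ᶜ (hE n).compl
      rw [← lintegral_inter_add_sdiff _ _ (hG' (n + 1)), ← h3] at h4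
      calc c * μ (E (n + 1)) + ∫⁻ ω in (E (n + 1))ᶜ, N (n + 1) ω ∂μ
          ≤ c * (μ (E n) + μ ((E n)ᶜ ∩ G (n + 1))) + ∫⁻ ω in (E (n + 1))ᶜ, N (n + 1) ω ∂μ := by
            gcongr
        _ = c * μ (E n) + (c * μ ((E n)ᶜ ∩ G (n + 1)) +
              ∫⁻ ω in (E (n + 1))ᶜ, N (n + 1) ω ∂μ) := by rw [mul_add, add_assoc]
        _ ≤ c * μ (E n) + (∫⁻ ω in (E n)ᶜ ∩ G (n + 1), N (n + 1) ω ∂μ +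
              ∫⁻ ω in (E (n + 1))ᶜ, N (n + 1) ω ∂μ) := by
            gcongr
            exact hcG (n + 1) _ (hE' n).compl
        _ ≤ c * μ (E n) + ∫⁻ ω in (E n)ᶜ, N n ω ∂μ := by gcongr
  have hunion : {ω | ∃ t, c ≤ N t ω} = ⋃ n, E n := by
    ext ω
    simp only [E, G, Set.mem_iUnion, Finset.mem_range]
    constructor
    · rintro ⟨t, ht⟩
      exact ⟨t, t, Nat.lt_succ_self t, ht⟩
    · rintro ⟨n, t, -, ht⟩
      exact ⟨t, ht⟩
  have hmonoE : Monotone E := monotone_nat_of_le_succ fun n => by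
    rw [hEsucc]
    exact Set.subset_union_left
  rw [hunion, hmonoE.measure_iUnion, ENNReal.mul_iSup]
  exact iSup_le fun n => le_self_add.trans (key n)

/-- A conditionally sub-Gaussian exponential factor with a deterministic multiplier does not
increase integrals of weights known beforehand. -/
theorem lintegral_mul_exp_const_le {m m₀ : MeasurableSpace Ω} (hm : m ≤ m₀) {μ : Measure Ω}
    [IsProbabilityMeasure μ] {η : Ω → ℝ} (hη : Measurable η)
    (hint : ∀ ξ : ℝ, Integrable (fun ω => Real.exp (ξ * η ω)) μ)
    (hsub : ∀ ξ : ℝ, μ[fun ω => Real.exp (ξ * η ω) | m] ≤ᵐ[μ] fun _ => Real.exp (ξ ^ 2 / 2))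
    (ξ : ℝ) {Z : Ω → ℝ≥0∞} (hZ : Measurable[m] Z) :
    ∫⁻ ω, Z ω * ENNReal.ofReal (Real.exp (ξ * η ω - ξ ^ 2 / 2)) ∂μ ≤ ∫⁻ ω, Z ω ∂μ := by
  set f : Ω → ℝ≥0∞ := fun ω => ENNReal.ofReal (Real.exp (ξ * η ω - ξ ^ 2 / 2)) with hf
  have hfm : Measurable f := by fun_prop
  -- The conditional bound becomes an inequality of measures on `m`, so that any `m`-measurable
  -- weight can be integrated, without integrability of `Z`.
  have hle : (μ.withDensity f).trim hm ≤ μ.trim hm := by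
    refine Measure.le_iff.2 fun A hA => ?_
    rw [trim_measurableSet_eq hm hA, trim_measurableSet_eq hm hA, withDensity_apply _ (hm _ hA)]
    have h1 : ∀ ω, f ω = ENNReal.ofReal (Real.exp (-(ξ ^ 2 / 2))) *
        ENNReal.ofReal (Real.exp (ξ * η ω)) := by
      intro ω
      change ENNReal.ofReal (Real.exp (ξ * η ω - ξ ^ 2 / 2)) = _
      rw [← ENNReal.ofReal_mul (Real.exp_pos _).le, ← Real.exp_add]
      congr 2
      ring
    simp_rw [h1]
    rw [lintegral_const_mul' _ _ ENNReal.ofReal_ne_top,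
      ← ofReal_integral_eq_lintegral_ofReal (hint ξ).integrableOn
        (Filter.Eventually.of_forall fun _ => (Real.exp_pos _).le),
      ← setIntegral_condExp hm (hint ξ) hA]
    have h2 : ∫ ω in A, (μ[fun ω => Real.exp (ξ * η ω) | m]) ω ∂μ ≤
        ∫ _ω in A, Real.exp (ξ ^ 2 / 2) ∂μ :=
      setIntegral_mono_ae integrable_condExp.integrableOn (integrable_const _).integrableOn
        (hsub ξ)
    rw [setIntegral_const, smul_eq_mul] at h2
    calc _ ≤ ENNReal.ofReal (Real.exp (-(ξ ^ 2 / 2))) *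
          ENNReal.ofReal (μ.real A * Real.exp (ξ ^ 2 / 2)) := by gcongr
      _ = ENNReal.ofReal (μ.real A) := by
          rw [← ENNReal.ofReal_mul (Real.exp_pos _).le, mul_left_comm, ← Real.exp_add]
          simp
      _ = μ A := ofReal_measureReal
  calc ∫⁻ ω, Z ω * f ω ∂μ = ∫⁻ ω, (f * Z) ω ∂μ := by simp [mul_comm]
    _ = ∫⁻ ω, Z ω ∂(μ.withDensity f) :=
        (lintegral_withDensity_eq_lintegral_mul μ hfm (hZ.mono hm le_rfl)).symm
    _ = ∫⁻ ω, Z ω ∂((μ.withDensity f).trim hm) := (lintegral_trim hm hZ).symm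
    _ ≤ ∫⁻ ω, Z ω ∂(μ.trim hm) := lintegral_mono' hle le_rfl
    _ = ∫⁻ ω, Z ω ∂μ := lintegral_trim hm hZ

/-- A conditionally sub-Gaussian exponential factor with a multiplier known beforehand does not
increase integrals of weights known beforehand. -/
theorem lintegral_mul_exp_le {m m₀ : MeasurableSpace Ω} (hm : m ≤ m₀) {μ : Measure Ω}
    [IsProbabilityMeasure μ] {η : Ω → ℝ} (hη : Measurable η)
    (hint : ∀ ξ : ℝ, Integrable (fun ω => Real.exp (ξ * η ω)) μ)
    (hsub : ∀ ξ : ℝ, μ[fun ω => Real.exp (ξ * η ω) | m] ≤ᵐ[μ] fun _ => Real.exp (ξ ^ 2 / 2))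
    {u : Ω → ℝ} (hu : Measurable[m] u) {Z : Ω → ℝ≥0∞} (hZ : Measurable[m] Z) :
    ∫⁻ ω, Z ω * ENNReal.ofReal (Real.exp (u ω * η ω - u ω ^ 2 / 2)) ∂μ ≤ ∫⁻ ω, Z ω ∂μ := by
  -- On each level set of a simple multiplier the constant case applies, with the weight cut down to
  -- that set.
  have hsimple : ∀ s : @SimpleFunc Ω m ℝ,
      ∫⁻ ω, Z ω * ENNReal.ofReal (Real.exp (s ω * η ω - s ω ^ 2 / 2)) ∂μ ≤ ∫⁻ ω, Z ω ∂μ := by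
    intro s
    have hs : ∀ c, MeasurableSet[m] (s ⁻¹' {c}) := fun c => @SimpleFunc.measurableSet_fiber _ _ m s c
    have hZc : ∀ c, Measurable[m] ((s ⁻¹' {c}).indicator Z) := fun c => hZ.indicator (hs c)
    have hsum : ∀ (g : ℝ → Ω → ℝ≥0∞) ω, Z ω * g (s ω) ω =
        ∑ c ∈ @SimpleFunc.range _ _ m s, (s ⁻¹' {c}).indicator Z ω * g c ω := by
      intro g ω
      rw [Finset.sum_eq_single (s ω)]
      · simp
      · intro c _ hc
        rw [Set.indicator_of_notMem (by simpa using hc.symm), zero_mul]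
      · intro h
        exact absurd (@SimpleFunc.mem_range_self _ _ m s ω) h
    calc _ = ∫⁻ ω, ∑ c ∈ @SimpleFunc.range _ _ m s, (s ⁻¹' {c}).indicator Z ω *
            ENNReal.ofReal (Real.exp (c * η ω - c ^ 2 / 2)) ∂μ :=
          lintegral_congr fun ω => hsum
            (fun c ω => ENNReal.ofReal (Real.exp (c * η ω - c ^ 2 / 2))) ω
      _ = ∑ c ∈ @SimpleFunc.range _ _ m s, ∫⁻ ω, (s ⁻¹' {c}).indicator Z ω *
            ENNReal.ofReal (Real.exp (c * η ω - c ^ 2 / 2)) ∂μ :=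
          lintegral_finsetSum _ fun c _ => ((hZc c).mono hm le_rfl).mul (by fun_prop)
      _ ≤ ∑ c ∈ @SimpleFunc.range _ _ m s, ∫⁻ ω, (s ⁻¹' {c}).indicator Z ω ∂μ :=
          Finset.sum_le_sum fun c _ => lintegral_mul_exp_const_le hm hη hint hsub c (hZc c)
      _ = ∫⁻ ω, ∑ c ∈ @SimpleFunc.range _ _ m s, (s ⁻¹' {c}).indicator Z ω ∂μ :=
          (lintegral_finsetSum _ fun c _ => (hZc c).mono hm le_rfl).symm
      _ = ∫⁻ ω, Z ω ∂μ := lintegral_congr fun ω => by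
          have := hsum (fun _ _ => 1) ω
          simpa using this.symm
  have hsm : StronglyMeasurable[m] u := hu.stronglyMeasurable
  have hapm : ∀ n, Measurable (hsm.approx n) := fun n =>
    (@SimpleFunc.measurable _ _ m _ (hsm.approx n)).mono hm le_rfl
  have hlim : ∀ ω, Filter.Tendsto (fun n => Z ω * ENNReal.ofReal
      (Real.exp (hsm.approx n ω * η ω - hsm.approx n ω ^ 2 / 2))) Filter.atTop
      (nhds (Z ω * ENNReal.ofReal (Real.exp (u ω * η ω - u ω ^ 2 / 2)))) := by
    intro ω
    refine ENNReal.Tendsto.const_mul ?_ (Or.inl ?_)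
    · refine ENNReal.tendsto_ofReal ?_
      have hc : Continuous fun c : ℝ => Real.exp (c * η ω - c ^ 2 / 2) := by fun_prop
      exact (hc.tendsto (u ω)).comp (hsm.tendsto_approx ω)
    · simpa using Real.exp_pos _
  -- Fatou's lemma suffices, since only an upper bound is needed.
  calc _ = ∫⁻ ω, Filter.liminf (fun n => Z ω * ENNReal.ofReal
        (Real.exp (hsm.approx n ω * η ω - hsm.approx n ω ^ 2 / 2))) Filter.atTop ∂μ :=
        lintegral_congr fun ω => (hlim ω).liminf_eq.symm
    _ ≤ Filter.liminf (fun n => ∫⁻ ω, Z ω * ENNReal.ofReal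
        (Real.exp (hsm.approx n ω * η ω - hsm.approx n ω ^ 2 / 2)) ∂μ) Filter.atTop := by
        refine lintegral_liminf_le fun n => (hZ.mono hm le_rfl).mul ?_
        have := hapm n
        fun_prop
    _ ≤ ∫⁻ ω, Z ω ∂μ := by
        refine Filter.liminf_le_of_le (by isBoundedDefault) fun b hb => ?_
        obtain ⟨n, hn⟩ := hb.exists
        exact hn.trans (hsimple _)

theorem measurable_expFactor_uncurry [MeasurableSpace Ω] {x : ℕ → Ω → Vec d} {η : ℕ → Ω → ℝ}
    {t : ℕ} (hx : ∀ τ < t, Measurable (x τ)) (hη : ∀ τ < t, Measurable (η τ)) :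
    Measurable fun p : Ω × Vec d =>
      expFactor (fun τ => x τ p.1) (fun τ => η τ p.1) t p.2 := by
  unfold expFactor
  refine Real.measurable_exp.comp (Finset.measurable_fun_sum _ fun τ hτ => ?_)
  have h1 := hx τ (Finset.mem_range.1 hτ)
  have h2 := hη τ (Finset.mem_range.1 hτ)
  have h3 : Measurable fun p : Ω × Vec d => ⟪p.2, x τ p.1⟫ :=
    measurable_snd.inner (h1.comp measurable_fst)
  have h4 : Measurable fun p : Ω × Vec d => η τ p.1 := h2.comp measurable_fst
  fun_prop

theorem measurable_expFactor [MeasurableSpace Ω] {x : ℕ → Ω → Vec d} {η : ℕ → Ω → ℝ}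
    {t : ℕ} (hx : ∀ τ < t, Measurable (x τ)) (hη : ∀ τ < t, Measurable (η τ)) (ξ : Vec d) :
    Measurable fun ω => expFactor (fun τ => x τ ω) (fun τ => η τ ω) t ξ := by
  unfold expFactor
  refine Real.measurable_exp.comp (Finset.measurable_fun_sum _ fun τ hτ => ?_)
  have h1 : Measurable fun ω => ⟪ξ, x τ ω⟫ :=
    measurable_const.inner (hx τ (Finset.mem_range.1 hτ))
  have h2 := hη τ (Finset.mem_range.1 hτ)
  fun_prop

theorem measurable_gaussDensity (lam : ℝ) : Measurable (gaussDensity (d := d) lam) := by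
  unfold gaussDensity
  fun_prop

theorem measurable_mixture [MeasurableSpace Ω] (lam : ℝ) {x : ℕ → Ω → Vec d} {η : ℕ → Ω → ℝ}
    {t : ℕ} (hx : ∀ τ < t, Measurable (x τ)) (hη : ∀ τ < t, Measurable (η τ)) :
    Measurable fun ω => mixture lam (fun τ => x τ ω) (fun τ => η τ ω) t := by
  unfold mixture
  refine Measurable.lintegral_prod_right' (f := fun p : Ω × Vec d =>
    ENNReal.ofReal (gaussDensity lam p.2) *
      ENNReal.ofReal (expFactor (fun τ => x τ p.1) (fun τ => η τ p.1) t p.2)) ?_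
  exact ((measurable_gaussDensity lam).comp measurable_snd).ennreal_ofReal.mul
    (measurable_expFactor_uncurry hx hη).ennreal_ofReal

/-- Tonelli reduces the supermartingale property of the mixture to a single direction `ξ`, where the
new multiplier `⟪ξ, x t⟫` is known before the noise of round `t`. -/
theorem setLIntegral_mixture_succ_le {m m₀ : MeasurableSpace Ω} (hm : m ≤ m₀) {μ : Measure Ω}
    [IsProbabilityMeasure μ] (lam : ℝ) {x : ℕ → Ω → Vec d} {η : ℕ → Ω → ℝ} {t : ℕ}
    (hx : ∀ τ ≤ t, Measurable[m] (x τ)) (hη : ∀ τ < t, Measurable[m] (η τ))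
    (hηt : Measurable (η t)) (hint : ∀ ξ : ℝ, Integrable (fun ω => Real.exp (ξ * η t ω)) μ)
    (hsub : ∀ ξ : ℝ, μ[fun ω => Real.exp (ξ * η t ω) | m] ≤ᵐ[μ] fun _ => Real.exp (ξ ^ 2 / 2))
    {A : Set Ω} (hA : MeasurableSet[m] A) :
    ∫⁻ ω in A, mixture lam (fun τ => x τ ω) (fun τ => η τ ω) (t + 1) ∂μ ≤
      ∫⁻ ω in A, mixture lam (fun τ => x τ ω) (fun τ => η τ ω) t ∂μ := by
  have hx₀ : ∀ τ < t + 1, Measurable (x τ) := fun τ hτ =>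
    (hx τ (Nat.lt_succ_iff.1 hτ)).mono hm le_rfl
  have hη₀ : ∀ τ < t + 1, Measurable (η τ) := fun τ hτ => by
    rcases (Nat.lt_succ_iff.1 hτ).lt_or_eq with h | rfl
    · exact (hη τ h).mono hm le_rfl
    · exact hηt
  have hswap : ∀ n ≤ t + 1, ∫⁻ ω in A, mixture lam (fun τ => x τ ω) (fun τ => η τ ω) n ∂μ =
      ∫⁻ ξ : Vec d, ENNReal.ofReal (gaussDensity lam ξ) * ∫⁻ ω in A,
        ENNReal.ofReal (expFactor (fun τ => x τ ω) (fun τ => η τ ω) n ξ) ∂μ := by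
    intro n hn
    unfold mixture
    rw [lintegral_lintegral_swap]
    · refine lintegral_congr fun ξ => ?_
      rw [lintegral_const_mul' _ _ ENNReal.ofReal_ne_top]
    · exact (((measurable_gaussDensity lam).comp measurable_snd).ennreal_ofReal.mul
        (measurable_expFactor_uncurry (fun τ hτ => hx₀ τ (hτ.trans_le hn))
          fun τ hτ => hη₀ τ (hτ.trans_le hn)).ennreal_ofReal).aemeasurable
  rw [hswap (t + 1) le_rfl, hswap t (Nat.le_succ t)]
  refine lintegral_mono fun ξ => ?_
  simp only
  gcongr ENNReal.ofReal (gaussDensity lam ξ) * ?_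
  rw [← lintegral_indicator (hm _ hA), ← lintegral_indicator (hm _ hA)]
  have hmeas : Measurable[m] fun ω =>
      ENNReal.ofReal (expFactor (fun τ => x τ ω) (fun τ => η τ ω) t ξ) := by
    exact (@measurable_expFactor d Ω m x η t (fun τ hτ => hx τ hτ.le) hη ξ).ennreal_ofReal
  have hu : Measurable[m] fun ω => ⟪ξ, x t ω⟫ := by
    have : Measurable fun z : Vec d => ⟪ξ, z⟫ := by fun_prop
    exact this.comp (hx t le_rfl)
  refine le_trans (le_of_eq ?_) (lintegral_mul_exp_le hm hηt hint hsub hu (hmeas.indicator hA))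
  refine lintegral_congr fun ω => ?_
  by_cases hω : ω ∈ A
  · rw [Set.indicator_of_mem hω, Set.indicator_of_mem hω,
      expFactor, expFactor, ← ENNReal.ofReal_mul (Real.exp_pos _).le, ← Real.exp_add,
      Finset.sum_range_succ]
  · simp [hω]

/-! ### The filtration and validity of the confidence sets -/

namespace Problem

variable {P : Problem d K U} {x : ℕ → Ω → Vec d}
  {γ : ℕ → Option (Idx K U) → Ω → ℝ}

theorem measurable_action_info {τ t : ℕ} (h : τ ≤ t) : Measurable[P.info x γ t] (x τ) := by
  rw [measurable_iff_comap_le]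
  rcases h.lt_or_eq with h | rfl
  · exact (le_sup_left.trans le_sup_left).trans ((le_iSup (fun τ : Fin t =>
      MeasurableSpace.comap (x τ) inferInstance ⊔
      MeasurableSpace.comap (P.reward x γ τ) inferInstance ⊔
      ⨆ i, MeasurableSpace.comap (P.safety x γ τ i) inferInstance) ⟨τ, h⟩).trans le_sup_left)
  · exact le_sup_right

theorem measurable_reward_info {τ t : ℕ} (h : τ < t) :
    Measurable[P.info x γ t] (P.reward x γ τ) := by
  rw [measurable_iff_comap_le]
  exact (le_sup_right.trans le_sup_left).trans ((le_iSup (fun τ : Fin t =>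
      MeasurableSpace.comap (x τ) inferInstance ⊔
      MeasurableSpace.comap (P.reward x γ τ) inferInstance ⊔
      ⨆ i, MeasurableSpace.comap (P.safety x γ τ i) inferInstance) ⟨τ, h⟩).trans le_sup_left)

theorem measurable_safety_info {τ t : ℕ} (h : τ < t) (i : Idx K U) :
    Measurable[P.info x γ t] (P.safety x γ τ i) := by
  rw [measurable_iff_comap_le]
  exact ((le_iSup (fun i => MeasurableSpace.comap (P.safety x γ τ i) inferInstance) i).trans
    le_sup_right).trans ((le_iSup (fun τ : Fin t =>
      MeasurableSpace.comap (x τ) inferInstance ⊔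
      MeasurableSpace.comap (P.reward x γ τ) inferInstance ⊔
      ⨆ i, MeasurableSpace.comap (P.safety x γ τ i) inferInstance) ⟨τ, h⟩).trans le_sup_left)

theorem info_le {m : MeasurableSpace Ω} {t : ℕ} (hx : ∀ τ ≤ t, Measurable[m] (x τ))
    (hr : ∀ τ < t, Measurable[m] (P.reward x γ τ))
    (hs : ∀ τ < t, ∀ i, Measurable[m] (P.safety x γ τ i)) : P.info x γ t ≤ m := by
  refine sup_le (iSup_le fun τ => sup_le (sup_le ?_ ?_) (iSup_le fun i => ?_)) ?_
  · exact (hx τ τ.2.le).comap_le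
  · exact (hr τ τ.2).comap_le
  · exact (hs τ τ.2 i).comap_le
  · exact (hx t le_rfl).comap_le

theorem info_mono : Monotone (P.info x γ) := fun _ _ hst =>
  info_le (fun _ h => measurable_action_info (h.trans hst))
    (fun _ h => measurable_reward_info (h.trans_le hst))
    fun _ h i => measurable_safety_info (h.trans_le hst) i

theorem info_le_measurableSpace {m₀ : MeasurableSpace Ω} {μ : Measure Ω} (hx : ∀ t, Measurable (x t))
    (hγ : P.IsSubGaussianNoise μ x γ) (t : ℕ) : P.info x γ t ≤ m₀ := by
  refine info_le (fun τ _ => hx τ) (fun τ _ => ?_) fun τ _ i => ?_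
  · have h1 : Measurable fun ω => ⟪P.θ, x τ ω⟫ := measurable_const.inner (hx τ)
    exact h1.add (hγ.measurable τ none)
  · have h1 : Measurable fun ω => ⟪P.a i, x τ ω⟫ := measurable_const.inner (hx τ)
    exact h1.add (hγ.measurable τ (some i))

/-- Validity of one confidence ellipsoid, uniformly over time. -/
theorem measure_notMem_ellipsoid_le [MeasurableSpace Ω] {μ : Measure Ω} [IsProbabilityMeasure μ]
    (hx : ∀ t, Measurable (x t)) (hγ : P.IsSubGaussianNoise μ x γ) {lam δ : ℝ} (hlam : 0 < lam)
    (hδ : 0 < δ) (o : Option (Idx K U)) {v : Vec d} (hv : ‖v‖ ≤ 1) {y : ℕ → Ω → ℝ}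
    (hy : ∀ t ω, y t ω = ⟪v, x t ω⟫ + γ t o ω)
    (hym : ∀ τ t, τ < t → Measurable[P.info x γ t] (y τ)) :
    μ {ω | ∃ t, v ∉ ellipsoid U lam δ (fun t => x t ω) (fun t => y t ω) t} ≤
      ENNReal.ofReal (δ / ((U : ℝ) + 1)) := by
  have hη : ∀ τ t, τ < t → Measurable[P.info x γ t] (γ τ o) := by
    intro τ t h
    -- The noise is not a generator of the information, but past noise is recovered from response
    -- and action.
    have h1 : γ τ o = fun ω => y τ ω - ⟪v, x τ ω⟫ := by
      ext ω
      rw [hy]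
      ring
    rw [h1]
    have h2 : Measurable fun z : Vec d => ⟪v, z⟫ := by fun_prop
    exact (hym τ t h).sub (h2.comp (measurable_action_info h.le))
  have hville := ville μ (F := P.info x γ) info_mono (info_le_measurableSpace hx hγ)
    (N := fun t ω => mixture lam (fun τ => x τ ω) (fun τ => γ τ o ω) t)
    (fun t => @measurable_mixture d Ω (P.info x γ t) lam x (fun τ => γ τ o) t
      (fun τ hτ => measurable_action_info hτ.le) fun τ hτ => hη τ t hτ)
    (fun t A hA => setLIntegral_mixture_succ_le (info_le_measurableSpace hx hγ t) lam
      (η := fun τ => γ τ o)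
      (fun τ hτ => measurable_action_info hτ) (fun τ hτ => hη τ t hτ) (hγ.measurable t o)
      (hγ.integrable_exp t o) (hγ.subGaussian t o) hA)
    (by simp [mixture_zero hlam]) (ENNReal.ofReal (((U : ℝ) + 1) / δ))
  have hpos : 0 < ((U : ℝ) + 1) / δ := by positivity
  have hsub : {ω | ∃ t, v ∉ ellipsoid U lam δ (fun t => x t ω) (fun t => y t ω) t} ⊆
      {ω | ∃ t, ENNReal.ofReal (((U : ℝ) + 1) / δ) ≤
        mixture lam (fun τ => x τ ω) (fun τ => γ τ o ω) t} := by
    rintro ω ⟨t, ht⟩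
    refine ⟨t, not_lt.1 fun hlt => ht ?_⟩
    exact mem_ellipsoid_of_mixture_lt hlam hδ hv _ (fun τ => γ τ o ω) _ (fun τ => hy τ ω) t hlt
  refine (measure_mono hsub).trans ?_
  rw [mul_comm, ← ENNReal.le_div_iff_mul_le (Or.inl (ENNReal.ofReal_pos.2 hpos).ne')
    (Or.inl ENNReal.ofReal_ne_top)] at hville
  refine hville.trans_eq ?_
  rw [one_div, ← ENNReal.ofReal_inv_of_pos hpos, inv_div]

/-- With probability `1 - δ`, all confidence ellipsoids are valid at all times. -/
theorem measure_not_all_valid_le [MeasurableSpace Ω] {μ : Measure Ω} [IsProbabilityMeasure μ] (hP : P.IsBounded)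
    (hx : ∀ t, Measurable (x t)) (hγ : P.IsSubGaussianNoise μ x γ) {lam δ : ℝ} (hlam : 0 < lam)
    (hδ : 0 < δ) :
    μ {ω | ¬ ∀ t, P.θ ∈ ellipsoid U lam δ (fun t => x t ω) (fun t => P.reward x γ t ω) t ∧
        ∀ i : Fin U, P.a (Sum.inr i) ∈ ellipsoid U lam δ (fun t => x t ω)
          (fun t => P.safety x γ t (Sum.inr i) ω) t} ≤ ENNReal.ofReal δ := by
  set E₀ := {ω | ∃ t, P.θ ∉ ellipsoid U lam δ (fun t => x t ω) (fun t => P.reward x γ t ω) t}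
  set E : Fin U → Set Ω := fun i => {ω | ∃ t, P.a (Sum.inr i) ∉ ellipsoid U lam δ
    (fun t => x t ω) (fun t => P.safety x γ t (Sum.inr i) ω) t}
  have h0 : μ E₀ ≤ ENNReal.ofReal (δ / ((U : ℝ) + 1)) :=
    measure_notMem_ellipsoid_le hx hγ hlam hδ none hP.norm_objective_le (fun _ _ => rfl)
      fun _ _ h => measurable_reward_info h
  have h1 : ∀ i, μ (E i) ≤ ENNReal.ofReal (δ / ((U : ℝ) + 1)) := fun i =>
    measure_notMem_ellipsoid_le hx hγ hlam hδ (some (Sum.inr i)) (hP.norm_constraint_le _)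
      (fun _ _ => rfl) fun _ _ h => measurable_safety_info h _
  -- Known constraints need no ellipsoid, so the union runs over `U + 1` events of probability at
  -- most `δ / (U + 1)` each.
  calc _ ≤ μ (E₀ ∪ ⋃ i, E i) := by
        refine measure_mono fun ω hω => ?_
        by_contra hn
        simp only [E₀, E, Set.mem_union, Set.mem_iUnion, Set.mem_ofPred_eq] at hn
        push Not at hn
        exact hω fun t => ⟨hn.1 t, fun i => hn.2 i t⟩
    _ ≤ μ E₀ + ∑ i, μ (E i) :=
        (measure_union_le _ _).trans (add_le_add le_rfl (measure_iUnion_fintype_le μ E))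
    _ ≤ ENNReal.ofReal (δ / ((U : ℝ) + 1)) + ∑ _i : Fin U, ENNReal.ofReal (δ / ((U : ℝ) + 1)) :=
        add_le_add h0 (Finset.sum_le_sum fun i _ => h1 i)
    _ = ENNReal.ofReal δ := by
        rw [← ENNReal.ofReal_sum_of_nonneg fun _ _ => by positivity,
          ← ENNReal.ofReal_add (by positivity) (by positivity)]
        congr 1
        simp
        field_simp
        ring

end Problem

end Supermartingale

/-! ### Regret bounds -/

theorem radius_pos {lam : ℝ} (hlam : 0 < lam) (δ : ℝ) (x : ℕ → Vec d) (t : ℕ) :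
    0 < radius U lam δ x t := by
  unfold radius
  have := Real.sqrt_pos.2 hlam
  positivity

/-- The width of the confidence sets in the direction of the action of round `t`. -/
def width (U : ℕ) (lam δ : ℝ) (x : ℕ → Vec d) (t : ℕ) : ℝ :=
  2 * (radius U lam δ x t * matNorm (design lam x t)⁻¹ (x t))

/-- From `(p + q)² ≤ 2 p² + 2 q²` and monotonicity of the determinant; the bound depends on the
horizon `T` only, so it can be pulled out of a sum over `t`. -/
theorem sq_radius_le {lam δ : ℝ} (hlam : 0 < lam) (hδ0 : 0 < δ) (hδ1 : δ < 1) (x : ℕ → Vec d)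
    {t T : ℕ} (htT : t ≤ T) :
    radius U lam δ x t ^ 2 ≤ 4 * Real.log (((U : ℝ) + 1) / δ) +
      2 * Real.log ((design lam x T).det / lam ^ d) + 2 * lam := by
  have hmono := det_design_mono hlam x
  have hVt := det_design_pos hlam x t
  have hdet : (lam • (1 : Matrix (Fin d) (Fin d) ℝ)).det = lam ^ d := by simp
  have hone : 1 ≤ (design lam x t).det / lam ^ d := by
    rw [one_le_div (by positivity), ← det_design_zero lam x]
    exact hmono (Nat.zero_le t)
  have hUδ : 1 ≤ ((U : ℝ) + 1) / δ := by
    rw [one_le_div hδ0]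
    have : (0 : ℝ) ≤ U := by positivity
    linarith
  have hlog : Real.log (((U : ℝ) + 1) * √(design lam x t).det / √(lam ^ d) / δ) =
      Real.log (((U : ℝ) + 1) / δ) + Real.log ((design lam x t).det / lam ^ d) / 2 := by
    have h1 : ((U : ℝ) + 1) * √(design lam x t).det / √(lam ^ d) / δ =
        ((U : ℝ) + 1) / δ * √((design lam x t).det / lam ^ d) := by
      rw [Real.sqrt_div' _ (by positivity)]
      field_simp
    rw [h1, Real.log_mul (by positivity) (by positivity), Real.log_sqrt (by positivity)]
  have h0 : 0 ≤ Real.log (((U : ℝ) + 1) / δ) := Real.log_nonneg hUδ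
  have h1 : 0 ≤ Real.log ((design lam x t).det / lam ^ d) := Real.log_nonneg hone
  have h2 : Real.log ((design lam x t).det / lam ^ d) ≤
      Real.log ((design lam x T).det / lam ^ d) :=
    Real.log_le_log (by positivity) (div_le_div_of_nonneg_right (hmono htT) (by positivity))
  rw [radius, hdet, hlog]
  set L := 2 * (Real.log (((U : ℝ) + 1) / δ) + Real.log ((design lam x t).det / lam ^ d) / 2)
    with hLdef
  have hL : 0 ≤ L := by positivity
  have h3 := Real.sq_sqrt hL
  have h4 := Real.sq_sqrt hlam.le
  have h5 : (√L + √lam) ^ 2 ≤ 2 * √L ^ 2 + 2 * √lam ^ 2 := by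
    nlinarith [sq_nonneg (√L - √lam)]
  rw [h3, h4] at h5
  linarith

/-- The condition `T ≥ 2` lets a multiple of `log T` absorb the constant `log (1 + 1 / lam)`. -/
theorem log_det_design_le {lam : ℝ} (hlam : 0 < lam) {x : ℕ → Vec d} (hx : ∀ t, ‖x t‖ ≤ 1)
    {T : ℕ} (hT : 2 ≤ T) :
    Real.log ((design lam x T).det / lam ^ d) ≤
      (1 + Real.log (1 + 1 / lam) / Real.log 2) * (d * Real.log T) := by
  have hT' : (2 : ℝ) ≤ T := by exact_mod_cast hT
  have hl2 : 0 < Real.log 2 := Real.log_pos (by norm_num)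
  have hlT : Real.log 2 ≤ Real.log T := Real.log_le_log (by norm_num) hT'
  have h0 : 0 ≤ Real.log (1 + 1 / lam) :=
    Real.log_nonneg (le_add_of_nonneg_right (by positivity))
  have h1 : (design lam x T).det / lam ^ d ≤ ((1 + 1 / lam) * T) ^ d := by
    rw [div_le_iff₀ (by positivity), ← mul_pow]
    refine (det_design_le hlam hx T).trans (pow_le_pow_left₀ (by positivity) ?_ d)
    have : (1 + 1 / lam) * T * lam = lam * T + T := by field_simp
    rw [this]
    nlinarith
  refine (Real.log_le_log (div_pos (det_design_pos hlam x T) (by positivity)) h1).trans ?_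
  rw [Real.log_pow, Real.log_mul (by positivity) (by positivity)]
  have h2 : Real.log (1 + 1 / lam) ≤ Real.log (1 + 1 / lam) / Real.log 2 * Real.log T := by
    rw [div_mul_eq_mul_div, le_div_iff₀ hl2]
    exact mul_le_mul_of_nonneg_left hlT h0
  calc (d : ℝ) * (Real.log (1 + 1 / lam) + Real.log T)
      ≤ d * (Real.log (1 + 1 / lam) / Real.log 2 * Real.log T + Real.log T) := by gcongr
    _ = _ := by ring

/-- The squared widths sum up to `O ((d log T)²)`. -/
theorem exists_sum_sq_width_le (U : ℕ) {lam δ : ℝ} (hlam : 0 < lam) (hδ0 : 0 < δ) (hδ1 : δ < 1) :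
    ∃ C : ℝ, ∀ (d : ℕ) (x : ℕ → Vec d), (∀ t, ‖x t‖ ≤ 1) → ∀ T : ℕ, 2 ≤ T →
      ∑ t ∈ Finset.range T, width U lam δ x t ^ 2 ≤ C * ((d : ℝ) * Real.log T) ^ 2 := by
  set c := 1 + Real.log (1 + 1 / lam) / Real.log 2 with hc
  set A := 4 * Real.log (((U : ℝ) + 1) / δ) + 2 * lam with hA
  have hl2 : 0 < Real.log 2 := Real.log_pos (by norm_num)
  have hc0 : 0 ≤ c := by
    have : 0 ≤ Real.log (1 + 1 / lam) :=
      Real.log_nonneg (le_add_of_nonneg_right (by positivity))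
    positivity
  have hA0 : 0 ≤ A := by
    have : 0 ≤ Real.log (((U : ℝ) + 1) / δ) := Real.log_nonneg (by
      rw [one_le_div hδ0]
      have : (0 : ℝ) ≤ U := by positivity
      linarith)
    positivity
  refine ⟨4 * (1 + 1 / lam) * c * (A / Real.log 2 + 2 * c), fun d x hx T hT => ?_⟩
  set L := Real.log ((design lam x T).det / lam ^ d) with hL
  set q := (d : ℝ) * Real.log T with hq
  have hT' : (2 : ℝ) ≤ T := by exact_mod_cast hT
  have hlT : Real.log 2 ≤ Real.log T := Real.log_le_log (by norm_num) hT'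
  have hq0 : 0 ≤ q := by positivity
  -- This absorbs the part linear in `q` that comes from the constant `A` in the squared radius. It
  -- uses `d ≤ d²` and `log 2 ≤ log T`, so the constant is free of `d` and `T`.
  have hqsq : q * Real.log 2 ≤ q ^ 2 := by
    have hd : (d : ℝ) ≤ (d : ℝ) ^ 2 := by exact_mod_cast Nat.le_self_pow two_ne_zero d
    calc q * Real.log 2 ≤ q * Real.log T := mul_le_mul_of_nonneg_left hlT hq0
      _ = d * Real.log T ^ 2 := by rw [hq]; ring
      _ ≤ d ^ 2 * Real.log T ^ 2 := mul_le_mul_of_nonneg_right hd (sq_nonneg _)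
      _ = q ^ 2 := by rw [hq]; ring
  have hLq : L ≤ c * q := log_det_design_le hlam hx hT
  have hL0 : 0 ≤ L := Real.log_nonneg (by
    rw [one_le_div (by positivity), ← det_design_zero lam x]
    exact det_design_mono hlam x (Nat.zero_le T))
  calc ∑ t ∈ Finset.range T, width U lam δ x t ^ 2
      ≤ ∑ t ∈ Finset.range T, 4 * (A + 2 * L) * matNorm (design lam x t)⁻¹ (x t) ^ 2 := by
        refine Finset.sum_le_sum fun t ht => ?_
        have h1 := sq_radius_le (U := U) hlam hδ0 hδ1 x (Finset.mem_range.1 ht).le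
        rw [width, mul_pow, mul_pow, ← mul_assoc]
        refine mul_le_mul_of_nonneg_right ?_ (sq_nonneg _)
        linarith
    _ = 4 * (A + 2 * L) * ∑ t ∈ Finset.range T, matNorm (design lam x t)⁻¹ (x t) ^ 2 := by
        rw [Finset.mul_sum]
    _ ≤ 4 * (A + 2 * L) * ((1 + 1 / lam) * L) :=
        mul_le_mul_of_nonneg_left (sum_sq_width_le hlam hx T) (by positivity)
    _ ≤ 4 * (A + 2 * (c * q)) * ((1 + 1 / lam) * (c * q)) := by gcongr
    _ = 4 * (1 + 1 / lam) * c * (A / Real.log 2 * (q * Real.log 2) + 2 * c * q ^ 2) := by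
        field_simp
    _ ≤ 4 * (1 + 1 / lam) * c * (A / Real.log 2 * q ^ 2 + 2 * c * q ^ 2) := by gcongr
    _ = _ := by ring

/-! ### From widths to regret -/

namespace Problem

/-- One round of a run in which the confidence sets are valid. -/
theorem IsDOSLB.round_bounds {P : Problem d K U} (hP : P.IsPolytopal) (hN : P.IsNondegenerate)
    {xs : Vec d} (hxs : P.IsUniqueOptimum xs) {lam δ : ℝ} (hlam : 0 < lam) {x : ℕ → Vec d}
    {r : ℕ → ℝ} {s : ℕ → Idx K U → ℝ} (hrun : P.IsDOSLB lam δ x r s) {t : ℕ}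
    (hθ : P.θ ∈ ellipsoid U lam δ x r t)
    (ha : ∀ i : Fin U, P.a (Sum.inr i) ∈ ellipsoid U lam δ x (fun t => s t (Sum.inr i)) t) :
    (∀ i, ⟪P.a i, x t⟫ - P.α i ≤ width U lam δ x t) ∧ ⟪P.θ, xs - x t⟫ ≤ width U lam δ x t ∧
      (0 < ⟪P.θ, xs - x t⟫ → P.gap xs ≤ width U lam δ x t) := by
  obtain ⟨B, D, hB, hBD, hDinj, -, hD, -⟩ := exists_factorization (design_posDef hlam x t)
  have hell : ∀ y : ℕ → ℝ, ellipsoid U lam δ x y t =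
      {v | ‖B (v - estimate lam x y t)‖ ≤ radius U lam δ x t} := by
    intro y
    unfold ellipsoid
    simp only [hB]
  rw [width, hD]
  rw [hell] at hθ
  refine Problem.round_bounds hP hN hxs hBD hDinj (radius_pos hlam δ x t)
    (conf := P.confSet lam δ x s t) (fun _ => rfl) (fun i => hell _) hθ (fun i => ?_) rfl (hell r)
    (hrun t).2
  have := ha i
  rw [hell] at this
  exact this

/-- A positive loss requires `ρ t` to be at least the gap, and a positive excess over `ε` requires
`ρ t ≥ ε`. Above a threshold `b` one has `ρ ≤ ρ² / b`, which makes the square-summable widths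
sufficient. -/
theorem relaxedRegret_le {P : Problem d K U} {xs : Vec d} {x : ℕ → Vec d} {ρ : ℕ → ℝ}
    (hρ : ∀ t, 0 ≤ ρ t) (hviol : ∀ t i, ⟪P.a i, x t⟫ - P.α i ≤ ρ t)
    (hopt : ∀ t, ⟪P.θ, xs - x t⟫ ≤ ρ t) (hgap : ∀ t, 0 < ⟪P.θ, xs - x t⟫ → P.gap xs ≤ ρ t)
    (hpos : 0 < P.gap xs) {ε : ℝ} (hε : 0 < ε) (T : ℕ) :
    P.relaxedRegret xs ε x T ≤
      (∑ t ∈ Finset.range T, ρ t ^ 2) * (1 / P.gap xs + 1 / ε) := by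
  have hself : ∀ {b c : ℝ}, 0 < b → 0 ≤ c → b ≤ c → c ≤ c ^ 2 * (1 / b) := by
    intro b c hb hc hbc
    rw [mul_one_div, le_div_iff₀ hb, sq]
    exact mul_le_mul_of_nonneg_left hbc hc
  rw [relaxedRegret, Finset.sum_mul]
  refine Finset.sum_le_sum fun t _ => ?_
  rw [mul_add]
  have h1 : 0 ≤ ρ t ^ 2 * (1 / P.gap xs) := by positivity
  have h2 : 0 ≤ ρ t ^ 2 * (1 / ε) := by positivity
  refine max_le ?_ (Real.iSup_le (fun i => max_le ?_ (by positivity)) (by positivity))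
  · rcases le_or_gt ⟪P.θ, xs - x t⟫ 0 with h | h
    · linarith
    · have := hself hpos (hρ t) (hgap t h)
      linarith [hopt t]
  · rcases le_or_gt (⟪P.a i, x t⟫ - P.α i) ε with h | h
    · linarith
    · have := hself hε (hρ t) (h.le.trans (hviol t i))
      linarith [hviol t i]

/-- Each counted round has `ρ t > ε` and so contributes at least `1` to `∑ ρ t ^ 2 / ε ^ 2`. -/
theorem violationCount_le {P : Problem d K U} {x : ℕ → Vec d} {ρ : ℕ → ℝ}
    (hviol : ∀ t i, ⟪P.a i, x t⟫ - P.α i ≤ ρ t) {ε : ℝ} (hε : 0 < ε) (T : ℕ) :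
    (P.violationCount ε x T : ℝ) ≤ (∑ t ∈ Finset.range T, ρ t ^ 2) / ε ^ 2 := by
  classical
  rw [violationCount, Finset.card_eq_sum_ones, Nat.cast_sum, Finset.sum_div]
  refine (Finset.sum_le_sum fun t ht => ?_).trans
    (Finset.sum_le_sum_of_subset_of_nonneg (Finset.filter_subset _ _) fun t _ _ => by positivity)
  obtain ⟨i, hi⟩ := (Finset.mem_filter.1 ht).2
  rw [Nat.cast_one, one_le_div (by positivity)]
  exact pow_le_pow_left₀ hε.le (hi.le.trans (hviol t i)) 2

end Problem

end SafeBandit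

end

theorem mainTheorem2 (U : ℕ) (lam δ : ℝ) (hlam : 0 < lam) (hδ0 : 0 < δ) (hδ1 : δ < 1) :
    ∃ C : ℝ, ∀ (d K : ℕ) (P : SafeBandit.Problem d K U) (xs : SafeBandit.Vec d),
      P.IsBounded → P.IsUniqueOptimum xs → P.IsPolytopal → P.IsNondegenerate →
      ∀ (Ω : Type*) [MeasurableSpace Ω] (μ : Measure Ω) [IsProbabilityMeasure μ]
        (x : ℕ → Ω → SafeBandit.Vec d)
        (γ : ℕ → Option (SafeBandit.Idx K U) → Ω → ℝ),
        (∀ t, Measurable (x t)) →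
        P.IsSubGaussianNoise μ x γ →
        (∀ ω, P.IsDOSLB lam δ (fun t => x t ω) (fun t => P.reward x γ t ω)
          (fun t i => P.safety x γ t i ω)) →
        μ {ω | ¬ ∀ T : ℕ, 2 ≤ T → ∀ ε : ℝ, 0 < ε →
            (0 < P.gap xs →
              P.relaxedRegret xs ε (fun t => x t ω) T ≤
                C * ((d : ℝ) * Real.log T) ^ 2 * (1 / P.gap xs + 1 / ε)) ∧
            (P.violationCount ε (fun t => x t ω) T : ℝ) ≤
              C * ((d : ℝ) ^ 2 * Real.log T ^ 2 / ε ^ 2)} ≤ ENNReal.ofReal δ := by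
  obtain ⟨C, hC⟩ := SafeBandit.exists_sum_sq_width_le U hlam hδ0 hδ1
  refine ⟨C, fun d K P xs hP hxs hpoly hN Ω _ μ _ x γ hx hγ hrun => ?_⟩
  -- The failure event lies in the event that some ellipsoid misses its parameter at some time. This
  -- one event serves all `T` and `ε`.
  refine (measure_mono fun ω hω => ?_).trans
    (SafeBandit.Problem.measure_not_all_valid_le hP hx hγ hlam hδ0)
  simp only [Set.mem_ofPred_eq] at hω ⊢
  contrapose! hω
  intro T hT ε hε
  have hround := fun t => (hrun ω).round_bounds hpoly hN hxs hlam (hω t).1 (hω t).2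
  have hρ : ∀ t, 0 ≤ SafeBandit.width U lam δ (fun t => x t ω) t := fun t =>
    mul_nonneg zero_le_two
      (mul_nonneg (SafeBandit.radius_pos hlam δ _ t).le (Real.sqrt_nonneg _))
  have hsum := hC d (fun t => x t ω) (fun t => hP.norm_domain_le _ (hrun ω t).1.1) T hT
  refine ⟨fun hpos => ?_, ?_⟩
  · refine (SafeBandit.Problem.relaxedRegret_le hρ (fun t => (hround t).1)
      (fun t => (hround t).2.1) (fun t => (hround t).2.2) hpos hε T).trans ?_
    exact mul_le_mul_of_nonneg_right hsum (by positivity)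
  · refine (SafeBandit.Problem.violationCount_le (fun t => (hround t).1) hε T).trans ?_
    rw [mul_div_assoc', ← mul_pow]
    exact div_le_div_of_nonneg_right hsum (by positivity)
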